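/- Let $p$ be a prime, $n\ge 0$, let $K$ be an arbitrary field of characteristic $p$, and let $A$ be a finite abelian group of exponent dividing $p^n$. A twist for the group algebra $K[A]$ is an invertible $J\in K[A]\otimes_K K[A]$ such that $(\Delta\otimes \mathrm{id})(J)(J\otimes 1)=(\mathrm{id}\otimes\Delta)(J)(1\otimes J)$ and $(\varepsilon\otimes\mathrm{id})(J)=1=(\mathrm{id}\otimes\varepsilon)(J)$. Let $H^2_{\rm inv}(A,K)$ be the group (under multiplication) of twists for $K[A]$ modulo gauge equivalence, where $J\sim (x\otimes x)\,J\,\Delta(x)^{-1}$ for $x\in K[A]^\times$ with $\varepsilon(x)=1$. Let $W_n$ denote $p$-typical Witt vectors of length $n$, let $\wp(x)=F(x)-x$ with $F(x_0,\dots,x_{n-1})=(x_0^p,\dots,x_{n-1}^p)$, and let $A^\vee=\mathrm{Hom}(A,\mathbb Z/p^n\mathbb Z)$. Let $K^s$ be a separable closure of $K$ and $G=\mathrm{Gal}(K^s/K)$, acting on the coefficients of $K^s[A]$ and on the coordinates of $W_n(K^s)$. (1) There is a canonical group isomorphism $$\Phi: H^2_{\rm inv}(A,K)\xrightarrow{\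 \cong\ }\mathrm{Hom}\bigl(A^\vee, W_n(K)/\wp(W_n(K))\bigr).$$ It is described as follows. For every twist $J$ there are $x\in K^s[A]^\times$ and a map $\rho:G\to A$ such that $J=(x\otimes x)\Delta(x)^{-1}$ in $K^s[A]\otimes_{K^s} K^s[A]$ and $g(x)=\rho(g)\,x$ for all $g\in G$, and such that for every $\chi\in A^\vee$ there are $w\in W_n(K)$ representing $\Phi([J])(\chi)$ and $y\in W_n(K^s)$ with $\wp(y)=w$ and $g(y)-y=\chi(\rho(g))\in\mathbb Z/p^n\mathbb Z=W_n(\mathbb F_p)\subseteq W_n(K^s)$ for all $g\in G$. (2) If moreover $K$ is perfect, there is a canonical group isomorphism $$\Psi: H^2_{\rm inv}(A,K)\xrightarrow{\ \cong\ } A\otimes_{\mathbb Z/p^n\mathbb Z}\bigl(W_n(K)/\wp(W_n(K))\bigr),$$ and $\Phi$ is the composition of $\Psi$ with the canonical map $A\otimes M\to \mathrm{Hom}(A^\vee,M)$, $a\otimes m\mapsto(\chi\mapsto\chi(a)m)$, where $M=W_n(K)/\wp(W_n(K))$. -/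

import Mathlib

open scoped TensorProduct

noncomputable section

/-! ### Twists for a commutative bialgebra and their gauge classes -/

section Twists

variable (K : Type*) [CommRing K] (H : Type*) [CommRing H] [Bialgebra K H]

/-- `Δ ⊗ id : H ⊗ H → H ⊗ H ⊗ H`. -/
def comulLeft : H ⊗[K] H →ₐ[K] H ⊗[K] (H ⊗[K] H) :=
  (Algebra.TensorProduct.assoc K K K H H H).toAlgHom.comp
    (Algebra.TensorProduct.map (Bialgebra.comulAlgHom K H) (AlgHom.id K H))

/-- `id ⊗ Δ : H ⊗ H → H ⊗ H ⊗ H`. -/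
def comulRight : H ⊗[K] H →ₐ[K] H ⊗[K] (H ⊗[K] H) :=
  Algebra.TensorProduct.map (AlgHom.id K H) (Bialgebra.comulAlgHom K H)

/-- `J ↦ J ⊗ 1`. -/
def tensorOne : H ⊗[K] H →ₐ[K] H ⊗[K] (H ⊗[K] H) :=
  (Algebra.TensorProduct.assoc K K K H H H).toAlgHom.comp
    (Algebra.TensorProduct.includeLeft : H ⊗[K] H →ₐ[K] (H ⊗[K] H) ⊗[K] H)

/-- `J ↦ 1 ⊗ J`. -/
def oneTensor : H ⊗[K] H →ₐ[K] H ⊗[K] (H ⊗[K] H) :=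
  Algebra.TensorProduct.includeRight

/-- `ε ⊗ id : H ⊗ H → H`. -/
def counitLeft : H ⊗[K] H →ₐ[K] H :=
  (Algebra.TensorProduct.lid K H).toAlgHom.comp
    (Algebra.TensorProduct.map (Bialgebra.counitAlgHom K H) (AlgHom.id K H))

/-- `id ⊗ ε : H ⊗ H → H`. -/
def counitRight : H ⊗[K] H →ₐ[K] H :=
  (Algebra.TensorProduct.rid K K H).toAlgHom.comp
    (Algebra.TensorProduct.map (AlgHom.id K H) (Bialgebra.counitAlgHom K H))

/-- The group of twists of a commutative bialgebra `H`: the invertible `J ∈ H ⊗ H` such that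
`(Δ ⊗ id)(J) (J ⊗ 1) = (id ⊗ Δ)(J) (1 ⊗ J)` and `(ε ⊗ id)(J) = 1 = (id ⊗ ε)(J)`.
(For commutative `H` they are closed under multiplication.) -/
def twistGroup : Subgroup (H ⊗[K] H)ˣ where
  carrier := {J |
    comulLeft K H (J : H ⊗[K] H) * tensorOne K H (J : H ⊗[K] H) =
      comulRight K H (J : H ⊗[K] H) * oneTensor K H (J : H ⊗[K] H) ∧
    counitLeft K H (J : H ⊗[K] H) = 1 ∧ counitRight K H (J : H ⊗[K] H) = 1}
  one_mem' := by simp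
  mul_mem' := by
    rintro I J ⟨h1, h2, h3⟩ ⟨k1, k2, k3⟩
    refine ⟨?_, by simp [h2, k2], by simp [h3, k3]⟩
    simp only [Units.val_mul, map_mul]
    rw [mul_mul_mul_comm, h1, k1, mul_mul_mul_comm]
  inv_mem' := by
    rintro J ⟨h1, h2, h3⟩
    have key : ∀ {S : Type _} [CommRing S] (f : H ⊗[K] H →+* S),
        f (J : H ⊗[K] H) * f ((J⁻¹ : (H ⊗[K] H)ˣ) : H ⊗[K] H) = 1 := by
      intro S _ f
      rw [← map_mul, Units.mul_inv, map_one]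
    refine ⟨?_, ?_, ?_⟩
    · have a := key (comulLeft K H).toRingHom
      have b := key (tensorOne K H).toRingHom
      have c := key (comulRight K H).toRingHom
      have d := key (oneTensor K H).toRingHom
      simp only [AlgHom.toRingHom_eq_coe, RingHom.coe_coe] at a b c d
      refine inv_unique (x := comulLeft K H (J : H ⊗[K] H) * tensorOne K H (J : H ⊗[K] H)) ?_ ?_
      · rw [mul_mul_mul_comm, a, b, mul_one]
      · rw [h1, mul_mul_mul_comm, c, d, mul_one]
    · have a := key (counitLeft K H).toRingHom
      simpa only [AlgHom.toRingHom_eq_coe, RingHom.coe_coe, h2, one_mul] using a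
    · have a := key (counitRight K H).toRingHom
      simpa only [AlgHom.toRingHom_eq_coe, RingHom.coe_coe, h3, one_mul] using a

/-- The twists gauge equivalent to `1`, that is, those of the form `(x ⊗ x) Δ(x)⁻¹` with `x ∈ H`
invertible and `ε(x) = 1`. -/
def gaugeTrivial : Subgroup (twistGroup K H) where
  carrier := {J | ∃ x : Hˣ, Coalgebra.counit (R := K) (x : H) = 1 ∧
    (J : (H ⊗[K] H)ˣ) * Coalgebra.comul (R := K) (x : H) = (x : H) ⊗ₜ[K] (x : H)}
  one_mem' := ⟨1, by simp, by simp [Algebra.TensorProduct.one_def]⟩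
  mul_mem' := by
    rintro I J ⟨x, hx, hx'⟩ ⟨y, hy, hy'⟩
    refine ⟨x * y, by simp [hx, hy], ?_⟩
    simp only [Subgroup.coe_mul, Units.val_mul, Bialgebra.comul_mul]
    rw [mul_mul_mul_comm, hx', hy', Algebra.TensorProduct.tmul_mul_tmul]
  inv_mem' := by
    rintro J ⟨x, hx, hx'⟩
    refine ⟨x⁻¹, ?_, ?_⟩
    · have := Bialgebra.counit_mul (R := K) (x : H) ((x⁻¹ : Hˣ) : H)
      rw [Units.mul_inv, Bialgebra.counit_one, hx, one_mul] at this
      exact this.symm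
    · have a : ((J : (H ⊗[K] H)ˣ) : H ⊗[K] H) *
          (((J⁻¹ : twistGroup K H) : (H ⊗[K] H)ˣ) : H ⊗[K] H) = 1 := by simp
      have b : Coalgebra.comul (R := K) (x : H) * Coalgebra.comul (R := K) ((x⁻¹ : Hˣ) : H) = 1 := by
        rw [← Bialgebra.comul_mul, Units.mul_inv, Bialgebra.comul_one]
      have c : ((x : H) ⊗ₜ[K] (x : H)) * (((x⁻¹ : Hˣ) : H) ⊗ₜ[K] ((x⁻¹ : Hˣ) : H)) = 1 := by
        rw [Algebra.TensorProduct.tmul_mul_tmul, Units.mul_inv, Algebra.TensorProduct.one_def]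
      refine inv_unique (x := ((J : (H ⊗[K] H)ˣ) : H ⊗[K] H) * Coalgebra.comul (R := K) (x : H)) ?_ ?_
      · rw [mul_mul_mul_comm, a, b, mul_one]
      · rw [hx', c]

/-- The group of gauge equivalence classes of twists of `H`, where `J` and
`(x ⊗ x) J Δ(x)⁻¹` are gauge equivalent. -/
abbrev TwistClass : Type _ := twistGroup K H ⧸ gaugeTrivial K H

end Twists

/-- `H²_inv(A, K)`: gauge equivalence classes of twists of the group algebra `K[A]`
(`A` is written additively, so the basis element of `a` is `AddMonoidAlgebra.single a 1`). -/
abbrev H2inv (A K : Type*) [AddCommGroup A] [Field K] : Type _ :=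
  TwistClass K (AddMonoidAlgebra K A)

/-! ### Truncated Witt vectors in characteristic `p` -/

section Witt

variable {p : ℕ} [Fact p.Prime] {n : ℕ}

/-- The ring homomorphism `W_n(R) → W_n(S)` that applies `f : R → S` to all coordinates. -/
def wittMap {R S : Type*} [CommRing R] [CommRing S] (f : R →+* S) :
    TruncatedWittVector p n R →+* TruncatedWittVector p n S where
  toFun x := TruncatedWittVector.mk p fun i => f (x.coeff i)
  map_one' := by
    have h : (1 : TruncatedWittVector p n S) = WittVector.truncate n (WittVector.map f 1) := by
      rw [map_one, map_one]
    rw [h, ← map_one (WittVector.truncate n : WittVector p R →+* _)]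
    ext i
    rw [TruncatedWittVector.coeff_mk, WittVector.coeff_truncate, WittVector.coeff_truncate,
      WittVector.map_coeff]
  map_zero' := by
    ext i; simp
  map_mul' x y := by
    obtain ⟨x, rfl⟩ := WittVector.truncate_surjective p n R x
    obtain ⟨y, rfl⟩ := WittVector.truncate_surjective p n R y
    have key : ∀ z : WittVector p R, (TruncatedWittVector.mk p fun i =>
        f ((WittVector.truncate n z).coeff i)) = WittVector.truncate n (WittVector.map f z) := by
      intro z; ext i; simp [WittVector.map_coeff]
    rw [← map_mul, key, key, key, map_mul, map_mul]
  map_add' x y := by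
    obtain ⟨x, rfl⟩ := WittVector.truncate_surjective p n R x
    obtain ⟨y, rfl⟩ := WittVector.truncate_surjective p n R y
    have key : ∀ z : WittVector p R, (TruncatedWittVector.mk p fun i =>
        f ((WittVector.truncate n z).coeff i)) = WittVector.truncate n (WittVector.map f z) := by
      intro z; ext i; simp [WittVector.map_coeff]
    rw [← map_add, key, key, key, map_add, map_add]

/-- The map `℘ : W_n(R) → W_n(R)`, `x ↦ F(x) - x`, where `F` raises all coordinates to the
power `p`. -/
def wittP (p : ℕ) [Fact p.Prime] (n : ℕ) (R : Type*) [CommRing R] [CharP R p] :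
    TruncatedWittVector p n R →+ TruncatedWittVector p n R :=
  (wittMap (frobenius R p)).toAddMonoidHom - AddMonoidHom.id _

/-- `W_n(R) / ℘(W_n(R))`. -/
abbrev WittModP (p : ℕ) [Fact p.Prime] (n : ℕ) (R : Type*) [CommRing R] [CharP R p] : Type _ :=
  TruncatedWittVector p n R ⧸ (wittP p n R).range

theorem pow_nsmul_truncatedWittVector {R : Type*} [CommRing R] [CharP R p]
    (x : TruncatedWittVector p n R) : p ^ n • x = 0 := by
  obtain ⟨x, rfl⟩ := WittVector.truncate_surjective p n R x
  rw [← map_nsmul, nsmul_eq_mul, mul_comm, Nat.cast_pow]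
  ext i
  rw [WittVector.coeff_truncate, WittVector.mul_pow_charP_coeff_zero x i.2,
    TruncatedWittVector.coeff_zero]

/-- `W_n(R) / ℘(W_n(R))` as a module over `ℤ / pⁿ` (`pⁿ = 0` in `W_n(R)`). -/
instance WittModP.instModule {R : Type*} [CommRing R] [CharP R p] :
    Module (ZMod (p ^ n)) (WittModP p n R) :=
  QuotientAddGroup.zmodModule fun x => by
    rw [pow_nsmul_truncatedWittVector]; exact zero_mem _

end Witt

/-! ### The canonical maps -/

/-- The base change map `K[A] ⊗ K[A] → L[A] ⊗ L[A]` for a field extension `L / K`. -/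
def tensorBaseChange (A K L : Type*) [AddCommGroup A] [Field K] [Field L] [Algebra K L] :
    AddMonoidAlgebra K A ⊗[K] AddMonoidAlgebra K A →ₐ[K]
      AddMonoidAlgebra L A ⊗[L] AddMonoidAlgebra L A :=
  Algebra.TensorProduct.lift
    (((Algebra.TensorProduct.includeLeft : AddMonoidAlgebra L A →ₐ[L] _).restrictScalars K).comp
      (AddMonoidAlgebra.mapAlgHom A (Algebra.ofId K L)))
    (((Algebra.TensorProduct.includeRight : AddMonoidAlgebra L A →ₐ[L] _).restrictScalars K).comp
      (AddMonoidAlgebra.mapAlgHom A (Algebra.ofId K L)))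
    fun _ _ => Commute.all _ _

/-- Let `L` be the separable closure of `K`, with the Galois group acting on the coefficients of
`L[A]`. `Trivializes J x ρ` says that the invertible element `x ∈ L[A]` trivializes the twist `J`
over `L`, that is `J = (x ⊗ x) Δ(x)⁻¹` in `L[A] ⊗ L[A]`, and that `g(x) = ρ(g) x` in `L[A]` for all
`g` in the Galois group, with `ρ(g) ∈ A`. -/
def Trivializes {A K : Type*} [AddCommGroup A] [Field K]
    (J : twistGroup K (AddMonoidAlgebra K A))
    (x : (AddMonoidAlgebra (SeparableClosure K) A)ˣ)
    (ρ : Gal(SeparableClosure K/K) → A) : Prop :=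
  tensorBaseChange A K (SeparableClosure K) (J : (AddMonoidAlgebra K A ⊗[K] AddMonoidAlgebra K A)ˣ) *
      Coalgebra.comul (R := SeparableClosure K) (x : AddMonoidAlgebra (SeparableClosure K) A) =
    (x : AddMonoidAlgebra (SeparableClosure K) A) ⊗ₜ[SeparableClosure K]
      (x : AddMonoidAlgebra (SeparableClosure K) A) ∧
  ∀ g : Gal(SeparableClosure K/K),
    AddMonoidAlgebra.mapAlgHom A (g : SeparableClosure K →ₐ[K] SeparableClosure K)
        (x : AddMonoidAlgebra (SeparableClosure K) A) =
      AddMonoidAlgebra.single (ρ g) 1 * (x : AddMonoidAlgebra (SeparableClosure K) A)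

/-- The separable closure of a field of characteristic `p` has characteristic `p`. -/
instance SeparableClosure.instCharP {p : ℕ} {K : Type*} [Field K] [CharP K p] :
    CharP (SeparableClosure K) p :=
  charP_of_injective_algebraMap (algebraMap K (SeparableClosure K)).injective p

/-- Let `L` be the separable closure of `K`. `IsArtinSchreierWitt c κ` says that the class
`c ∈ W_n(K) / ℘(W_n(K))` corresponds to the function `κ` from the Galois group to `ℤ / pⁿ`:
there are `w ∈ W_n(K)` representing `c` and `y ∈ W_n(L)` with `℘(y) = w`
such that `g(y) - y = κ(g)` in `W_n(L)` for all `g` in the Galois group. -/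
def IsArtinSchreierWitt {p : ℕ} [Fact p.Prime] {n : ℕ} {K : Type*} [Field K] [CharP K p]
    (c : WittModP p n K) (κ : Gal(SeparableClosure K/K) → ZMod (p ^ n)) : Prop :=
  ∃ (w : TruncatedWittVector p n K) (y : TruncatedWittVector p n (SeparableClosure K)),
    (QuotientAddGroup.mk w : WittModP p n K) = c ∧
    wittP p n (SeparableClosure K) y = wittMap (algebraMap K (SeparableClosure K)) w ∧
    ∀ g : Gal(SeparableClosure K/K),
      wittMap (g : SeparableClosure K →+* SeparableClosure K) y - y =
        ((κ g).val : TruncatedWittVector p n (SeparableClosure K))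

/-- The canonical map `A ⊗ M → Hom(A^∨, M)`, `a ⊗ m ↦ (χ ↦ χ(a) m)`, for `ℤ / N`-modules `A` and
`M`, where `A^∨ = Hom(A, ℤ / N)`. -/
def tensorToHom (N : ℕ) (A M : Type*) [AddCommGroup A] [AddCommGroup M] [Module (ZMod N) A]
    [Module (ZMod N) M] : A ⊗[ZMod N] M →+ ((A →+ ZMod N) →+ M) :=
  AddMonoidHom.flip
    { toFun := fun χ => (TensorProduct.lid (ZMod N) M).toLinearMap.toAddMonoidHom.comp
        (LinearMap.rTensor M (χ.toZModLinearMap N)).toAddMonoidHom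
      map_zero' := by
        ext t
        induction t with
        | zero => simp
        | tmul a m => simp
        | add s t hs ht => simp only [map_add, hs, ht]
      map_add' := fun χ ψ => by
        ext t
        induction t with
        | zero => simp
        | tmul a m => simp [add_smul]
        | add s t hs ht => simp only [map_add, hs, ht] }

theorem tensorToHom_tmul (N : ℕ) (A M : Type*) [AddCommGroup A] [AddCommGroup M]
    [Module (ZMod N) A] [Module (ZMod N) M] (a : A) (m : M) (χ : A →+ ZMod N) :
    tensorToHom N A M (a ⊗ₜ m) χ = χ a • m := by
  simp [tensorToHom]

end

/-! The proof identifies both sides with the group of continuous homomorphisms from `G` to `A`.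

Twists. A twist is a multiplicative 2-cocycle on the points of the commutative monoid scheme `Spec
K[A]`, so its quotient by its flip is multiplicative in each variable. Since the `pⁿ`-th power of
every element of `K[A]` is a scalar, the only idempotents are scalars; this forces the quotient to
be `1`, and every twist is symmetric (`twist_symmetric`). A symmetric twist `J` deforms the product
on the dual of `K[A]` into a commutative algebra on which `A` acts by translations. This algebra is
spanned by `p`-th powers, so its differentials vanish (`TwistedDual.formallyUnramified`) and it has
a point over `Kˢ`. Such a point is exactly an `x` with `J Δ(x) = x ⊗ x`. Two such `x` differ by a
group-like element, that is, an element of `A`; comparing `g(x)` with `x` gives `ρ : G → A`, a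
continuous homomorphism depending only on `J`. By Galois descent `ρ = 0` exactly when `J` is gauge
trivial, and averaging over a finite Galois orbit of trace one realizes every `ρ`.

Witt vectors. Artin-Schreier-Witt theory identifies `W_n(K) / ℘(W_n(K))` with the continuous
characters `G → ℤ/pⁿ`: over `Kˢ` the map `℘` is surjective with kernel `ℤ/pⁿ`, and the same orbit
average splits every character. Biduality of `A` turns a homomorphism from `A^∨` to such characters
into a homomorphism `G → A`.

Perfect case. For a cyclic summand `ℤ/pᵏ` of `A`, the canonical map becomes multiplication by `pⁿ⁻ᵏ`
from `M/pᵏM` to the `pᵏ`-torsion of `M`. It is bijective as soon as `pᵏ`-torsion is divisible by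
`pⁿ⁻ᵏ` for all `k ≤ n`, which follows by lifting to `W(K)`, where `p`-power multiples are the
kernels of truncation. -/

noncomputable section

/-! ### The dual algebra twisted by a symmetric twist -/

section TwistedDual

variable {K : Type*} [CommRing K] {H : Type*} [CommRing H] [Bialgebra K H]

/-- The functional `f ⊗ g` on `H ⊗ H`. -/
def dualTmul (f g : H →ₗ[K] K) : H ⊗[K] H →ₗ[K] K :=
  LinearMap.mul' K K ∘ₗ TensorProduct.map f g

@[simp] theorem dualTmul_tmul (f g : H →ₗ[K] K) (a b : H) :
    dualTmul f g (a ⊗ₜ b) = f a * g b := by simp [dualTmul]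

theorem dualTmul_comm (f g : H →ₗ[K] K) (T : H ⊗[K] H) :
    dualTmul f g (TensorProduct.comm K H H T) = dualTmul g f T := by
  induction T with
  | zero => simp
  | tmul a b => simp [mul_comm]
  | add S T hS hT => simp only [map_add, hS, hT]

/-- The functional `f ⊗ g ⊗ k` on `H ⊗ H ⊗ H`. -/
def dualTmul₃ (f g k : H →ₗ[K] K) : H ⊗[K] (H ⊗[K] H) →ₗ[K] K :=
  LinearMap.mul' K K ∘ₗ TensorProduct.map f (dualTmul g k)

theorem dualTmul₃_tmul (f g k : H →ₗ[K] K) (a : H) (T : H ⊗[K] H) :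
    dualTmul₃ f g k (a ⊗ₜ T) = f a * dualTmul g k T := by simp [dualTmul₃]

theorem dualTmul₃_assoc (f g k : H →ₗ[K] K) (T : H ⊗[K] H) (c : H) :
    dualTmul₃ f g k (TensorProduct.assoc K H H H (T ⊗ₜ c)) = dualTmul f g T * k c := by
  induction T with
  | zero => simp
  | tmul a b => simp [dualTmul₃_tmul, mul_assoc]
  | add S T hS hT => simp only [TensorProduct.add_tmul, map_add, hS, hT, add_mul]

/-- The product of functionals on `H` twisted by `J`: `(f * g)(h) = (f ⊗ g)(Δ(h) J)`. -/
def twistedMul (J : H ⊗[K] H) (f g : H →ₗ[K] K) : H →ₗ[K] K :=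
  dualTmul f g ∘ₗ LinearMap.mulRight K J ∘ₗ Coalgebra.comul

theorem twistedMul_apply (J : H ⊗[K] H) (f g : H →ₗ[K] K) (h : H) :
    twistedMul J f g h = dualTmul f g (Coalgebra.comul (R := K) h * J) := rfl

theorem dualTmul_twistedMul_left (J : H ⊗[K] H) (f g k : H →ₗ[K] K) (T : H ⊗[K] H) :
    dualTmul (twistedMul J f g) k T =
      dualTmul₃ f g k (comulLeft K H T * tensorOne K H J) := by
  induction T with
  | zero => simp
  | tmul a b =>
    have : comulLeft K H (a ⊗ₜ b) * tensorOne K H J =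
        TensorProduct.assoc K H H H ((Coalgebra.comul (R := K) a * J) ⊗ₜ b) := by
      have h : (Coalgebra.comul (R := K) a * J) ⊗ₜ[K] b =
          (Coalgebra.comul (R := K) a ⊗ₜ[K] b) * (J ⊗ₜ[K] (1 : H)) := by simp
      rw [h]
      exact (map_mul (Algebra.TensorProduct.assoc K K K H H H) _ _).symm
    rw [this, dualTmul₃_assoc, dualTmul_tmul, twistedMul_apply]
  | add S T hS hT => simp only [map_add, hS, hT, add_mul]

theorem dualTmul_twistedMul_right (J : H ⊗[K] H) (f g k : H →ₗ[K] K) (T : H ⊗[K] H) :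
    dualTmul f (twistedMul J g k) T =
      dualTmul₃ f g k (comulRight K H T * oneTensor K H J) := by
  induction T with
  | zero => simp
  | tmul a b =>
    have : comulRight K H (a ⊗ₜ b) * oneTensor K H J =
        a ⊗ₜ[K] (Coalgebra.comul (R := K) b * J) := by
      simp [comulRight, oneTensor]
    rw [this, dualTmul₃_tmul, dualTmul_tmul, twistedMul_apply]
  | add S T hS hT => simp only [map_add, hS, hT, add_mul]

theorem comulLeft_comul (h : H) :
    comulLeft K H (Coalgebra.comul (R := K) h) = comulRight K H (Coalgebra.comul (R := K) h) :=
  Coalgebra.coassoc_apply h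

/-- Both bracketings evaluate `f ⊗ g ⊗ k` on the iterated coproduct of `h` times one side of the
twist equation, so associativity is that equation combined with coassociativity. -/
theorem twistedMul_assoc (J : twistGroup K H) (f g k : H →ₗ[K] K) :
    twistedMul (J : (H ⊗[K] H)ˣ) (twistedMul (J : (H ⊗[K] H)ˣ) f g) k =
      twistedMul (J : (H ⊗[K] H)ˣ) f (twistedMul (J : (H ⊗[K] H)ˣ) g k) := by
  ext h
  rw [twistedMul_apply, twistedMul_apply, dualTmul_twistedMul_left, dualTmul_twistedMul_right,
    map_mul (comulLeft K H), map_mul (comulRight K H), mul_assoc, mul_assoc, J.2.1,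
    comulLeft_comul]

theorem dualTmul_counit_right (f : H →ₗ[K] K) (T : H ⊗[K] H) :
    dualTmul f Coalgebra.counit T = f (counitRight K H T) := by
  induction T with
  | zero => simp
  | tmul a b => simp [counitRight, mul_comm]
  | add S T hS hT => simp only [map_add, hS, hT]

theorem twistedMul_counit (J : twistGroup K H) (f : H →ₗ[K] K) :
    twistedMul (J : (H ⊗[K] H)ˣ) f Coalgebra.counit = f := by
  ext h
  have : counitRight K H (Coalgebra.comul (R := K) h) = h := by
    have := congrArg (TensorProduct.rid K H) (Coalgebra.lTensor_counit_comul (R := K) h)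
    rw [TensorProduct.rid_tmul, one_smul] at this
    exact this
  rw [twistedMul_apply, dualTmul_counit_right, map_mul, J.2.2.2, mul_one, this]

theorem twistedMul_comm [Coalgebra.IsCocomm K H] {J : H ⊗[K] H}
    (hJ : TensorProduct.comm K H H J = J) (f g : H →ₗ[K] K) :
    twistedMul J f g = twistedMul J g f := by
  ext h
  rw [twistedMul_apply, twistedMul_apply, ← dualTmul_comm]
  have : TensorProduct.comm K H H (Coalgebra.comul (R := K) h * J) =
      TensorProduct.comm K H H (Coalgebra.comul (R := K) h) * TensorProduct.comm K H H J :=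
    map_mul (Algebra.TensorProduct.comm K H H) _ _
  rw [this, hJ, Coalgebra.comm_comul]

theorem twistedMul_zero_twist (f g : H →ₗ[K] K) : twistedMul (0 : H ⊗[K] H) f g = 0 := by
  ext h
  simp [twistedMul_apply]

theorem twistedMul_add_twist (S T : H ⊗[K] H) (f g : H →ₗ[K] K) :
    twistedMul (S + T) f g = twistedMul S f g + twistedMul T f g := by
  ext h
  simp [twistedMul_apply, mul_add]

theorem twistedMul_smul_twist (c : K) (T : H ⊗[K] H) (f g : H →ₗ[K] K) :
    twistedMul (c • T) f g = c • twistedMul T f g := by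
  ext h
  simp [twistedMul_apply]

theorem dualTmul_zero_left (f : H →ₗ[K] K) : dualTmul 0 f = 0 := by
  rw [dualTmul, TensorProduct.map_zero_left, LinearMap.comp_zero]

theorem dualTmul_zero_right (f : H →ₗ[K] K) : dualTmul f 0 = 0 := by
  rw [dualTmul, TensorProduct.map_zero_right, LinearMap.comp_zero]

theorem twistedMul_add_left (J : H ⊗[K] H) (f g k : H →ₗ[K] K) :
    twistedMul J (f + g) k = twistedMul J f k + twistedMul J g k := by
  ext h
  simp [twistedMul_apply, dualTmul, TensorProduct.map_add_left]

theorem twistedMul_smul_left (J : H ⊗[K] H) (c : K) (f k : H →ₗ[K] K) :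
    twistedMul J (c • f) k = c • twistedMul J f k := by
  ext h
  simp [twistedMul_apply, dualTmul, TensorProduct.map_smul_left]

/-- Translation by a group-like element is an automorphism of the twisted dual. -/
theorem twistedMul_translate {J : H ⊗[K] H} {a : H} (ha : IsGroupLikeElem K a) (f g : H →ₗ[K] K) :
    twistedMul J (f ∘ₗ LinearMap.mulRight K a) (g ∘ₗ LinearMap.mulRight K a) =
      twistedMul J f g ∘ₗ LinearMap.mulRight K a := by
  have key (T : H ⊗[K] H) : dualTmul (f ∘ₗ LinearMap.mulRight K a) (g ∘ₗ LinearMap.mulRight K a) T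
      = dualTmul f g (T * (a ⊗ₜ a)) := by
    induction T with
    | zero => simp
    | tmul a b => simp
    | add S T hS hT => simp only [map_add, hS, hT, add_mul]
  ext h
  simp only [twistedMul_apply, key, LinearMap.comp_apply, LinearMap.mulRight_apply,
    Bialgebra.comul_mul, ha.comul_eq_tmul_self]
  rw [mul_right_comm]

variable [Coalgebra.IsCocomm K H] (J : twistGroup K H)

/-- The linear dual of a cocommutative bialgebra `H`, as an algebra with the product twisted
by a symmetric twist. -/
def TwistedDual (_ : twistGroup K H) : Type _ := H →ₗ[K] K

instance : AddCommGroup (TwistedDual J) := inferInstanceAs (AddCommGroup (H →ₗ[K] K))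

instance : Module K (TwistedDual J) := inferInstanceAs (Module K (H →ₗ[K] K))

/-- A functional on `H` as an element of the twisted dual. -/
def TwistedDual.of : (H →ₗ[K] K) ≃ₗ[K] TwistedDual J := LinearEquiv.refl K _

/-- A twist is symmetric if it is invariant under the flip of the two tensor factors. -/
class SymmetricTwist {K : Type*} [CommRing K] {H : Type*} [CommRing H] [Bialgebra K H]
    (J : twistGroup K H) : Prop where
  out : TensorProduct.comm K H H (J : (H ⊗[K] H)ˣ) = (J : (H ⊗[K] H)ˣ)

variable [hJ : SymmetricTwist J]

instance : CommRing (TwistedDual J) :=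
  { (inferInstance : AddCommGroup (TwistedDual J)) with
    mul f g := TwistedDual.of J (twistedMul (J : (H ⊗[K] H)ˣ) f g)
    one := TwistedDual.of J Coalgebra.counit
    mul_assoc := twistedMul_assoc J
    mul_comm := twistedMul_comm hJ.out
    mul_one := twistedMul_counit J
    one_mul f := (twistedMul_comm hJ.out _ _).trans (twistedMul_counit J f)
    right_distrib := twistedMul_add_left _
    left_distrib f g k := by
      refine (twistedMul_comm hJ.out _ _).trans ((twistedMul_add_left _ _ _ _).trans ?_)
      exact congrArg₂ _ (twistedMul_comm hJ.out _ _) (twistedMul_comm hJ.out _ _)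
    zero_mul f :=
      LinearMap.ext fun h => LinearMap.congr_fun (dualTmul_zero_left (K := K) (H := H) f) _
    mul_zero f :=
      LinearMap.ext fun h => LinearMap.congr_fun (dualTmul_zero_right (K := K) (H := H) f) _ }

instance : Algebra K (TwistedDual J) :=
  Algebra.ofModule (fun c f g => twistedMul_smul_left _ c f g) fun c f g =>
    (twistedMul_comm hJ.out _ _).trans ((twistedMul_smul_left _ c g f).trans
      (congrArg (c • ·) (twistedMul_comm hJ.out _ _)))

namespace TwistedDual

theorem of_mul (f g : H →ₗ[K] K) :
    of J f * of J g = of J (twistedMul (J : (H ⊗[K] H)ˣ) f g) := rfl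

theorem of_counit : of J (Coalgebra.counit : H →ₗ[K] K) = 1 := rfl

/-- Translation by a group-like element as a ring endomorphism of the twisted dual. -/
def translate {a : H} (ha : IsGroupLikeElem K a) : TwistedDual J →ₐ[K] TwistedDual J :=
  AlgHom.ofLinearMap
    ((of J).toLinearMap ∘ₗ LinearMap.lcomp K K (LinearMap.mulRight K a) ∘ₗ (of J).symm.toLinearMap)
    (LinearMap.ext fun h => by
      change Coalgebra.counit (R := K) (h * a) = Coalgebra.counit (R := K) h
      simp [ha.counit_eq_one])
    (fun f g => (twistedMul_translate ha f g).symm)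

theorem translate_of {a : H} (ha : IsGroupLikeElem K a) (f : H →ₗ[K] K) :
    translate J ha (of J f) = of J (f ∘ₗ LinearMap.mulRight K a) := rfl

end TwistedDual

end TwistedDual

/-! ### Twists as 2-cocycles on points -/

section Points

variable {K : Type*} [CommRing K] {H : Type*} [CommRing H] [Bialgebra K H]
  {S : Type*} [CommRing S] [Algebra K S]

/-- The product of two points of the affine monoid scheme `Spec H`. -/
def pointMul (x y : H →ₐ[K] S) : H →ₐ[K] S :=
  (Algebra.TensorProduct.productMap x y).comp (Bialgebra.comulAlgHom K H)

theorem pointMul_comm [Coalgebra.IsCocomm K H] (x y : H →ₐ[K] S) :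
    pointMul x y = pointMul y x := by
  have h : Algebra.TensorProduct.productMap x y =
      (Algebra.TensorProduct.productMap y x).comp
        (Algebra.TensorProduct.comm K H H).toAlgHom := by
    ext <;> simp
  ext a
  simp only [pointMul, AlgHom.comp_apply, Bialgebra.comulAlgHom_apply]
  rw [h, AlgHom.comp_apply]
  exact congrArg _ (Coalgebra.comm_comul K a)

/-- The value of an invertible element of `H ⊗ H` at a pair of points. -/
def evalPoints (x y : H →ₐ[K] S) : (H ⊗[K] H)ˣ →* Sˣ :=
  Units.map (Algebra.TensorProduct.productMap x y : H ⊗[K] H →* S)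

theorem coe_evalPoints (x y : H →ₐ[K] S) (J : (H ⊗[K] H)ˣ) :
    (evalPoints x y J : S) = Algebra.TensorProduct.productMap x y (J : H ⊗[K] H) := rfl

theorem evalPoints_cocycle (J : twistGroup K H) (x y z : H →ₐ[K] S) :
    evalPoints (pointMul x y) z J * evalPoints x y J =
      evalPoints x (pointMul y z) J * evalPoints y z J := by
  let π := Algebra.TensorProduct.productMap x (Algebra.TensorProduct.productMap y z)
  have h1 : π.comp (comulLeft K H) = Algebra.TensorProduct.productMap (pointMul x y) z := by
    have h : π.comp (Algebra.TensorProduct.assoc K K K H H H).toAlgHom =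
        Algebra.TensorProduct.productMap (Algebra.TensorProduct.productMap x y) z := by
      ext <;> simp [π, Algebra.TensorProduct.one_def]
    rw [comulLeft, ← AlgHom.comp_assoc, h]
    ext <;> simp [pointMul]
  have h2 : π.comp (tensorOne K H) = Algebra.TensorProduct.productMap x y := by
    ext <;> simp [π, tensorOne]
  have h3 : π.comp (comulRight K H) = Algebra.TensorProduct.productMap x (pointMul y z) := by
    ext <;> simp [π, comulRight, pointMul]
  have h4 : π.comp (oneTensor K H) = Algebra.TensorProduct.productMap y z := by
    ext <;> simp [π, oneTensor]
  have := congrArg π J.2.1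
  simp only [map_mul, ← AlgHom.comp_apply, h1, h2, h3, h4] at this
  exact Units.ext this

/-- The swapQuotientetrization of a twist is multiplicative in the first variable. -/
theorem evalPoints_pointMul_div_swap [Coalgebra.IsCocomm K H] (J : twistGroup K H)
    (x y z : H →ₐ[K] S) :
    evalPoints (pointMul x y) z J / evalPoints z (pointMul x y) J =
      evalPoints x z J / evalPoints z x J * (evalPoints y z J / evalPoints z y J) := by
  -- This is the classical argument that the antisymmetrization of a 2-cocycle on a commutative
  -- monoid is a bicharacter: three instances of the cocycle identity, with `z` moved through the
  -- three positions, are combined.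
  have c1 := evalPoints_cocycle J x y z
  have c2 := evalPoints_cocycle J z x y
  have c3 := evalPoints_cocycle J x z y
  rw [pointMul_comm z x] at c2
  rw [pointMul_comm z y] at c3
  generalize evalPoints (pointMul x y) z J.1 = a at *
  generalize evalPoints z (pointMul x y) J.1 = b at *
  generalize evalPoints x (pointMul y z) J.1 = t at *
  generalize evalPoints (pointMul x z) y J.1 = u at *
  generalize evalPoints x z J.1 = q₁ at *
  generalize evalPoints z x J.1 = q₂ at *
  generalize evalPoints y z J.1 = q₃ at *
  generalize evalPoints z y J.1 = q₄ at *
  generalize evalPoints x y J.1 = q₅ at *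
  rw [div_mul_div_comm, div_eq_div_iff_mul_eq_mul]
  refine mul_right_cancel (b := q₅ * u) ?_
  calc a * (q₂ * q₄) * (q₅ * u) = (a * q₅) * (u * q₂ * q₄) := by ac_rfl
    _ = (t * q₄) * (u * q₂) * q₃ := by rw [c1]; ac_rfl
    _ = q₁ * q₃ * b * (q₅ * u) := by rw [← c3, c2]; ac_rfl

/-- The quotient of an invertible element of `H ⊗ H` by its flip. -/
def swapQuotient (J : (H ⊗[K] H)ˣ) : (H ⊗[K] H)ˣ :=
  J / Units.map (Algebra.TensorProduct.comm K H H : H ⊗[K] H →* H ⊗[K] H) J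

theorem evalPoints_swapQuotient (J : (H ⊗[K] H)ˣ) (x y : H →ₐ[K] S) :
    evalPoints x y (swapQuotient J) = evalPoints x y J / evalPoints y x J := by
  rw [swapQuotient, map_div]
  congr 1
  have h : (Algebra.TensorProduct.productMap x y).comp
      (Algebra.TensorProduct.comm K H H).toAlgHom = Algebra.TensorProduct.productMap y x := by
    ext <;> simp
  ext
  exact AlgHom.congr_fun h J

end Points

theorem AddMonoidAlgebra.exists_eq_sum_single_tmul {K A : Type*} [CommRing K] [Fintype A] {M : Type*}
    [AddCommGroup M]
    [Module K M] (T : AddMonoidAlgebra K A ⊗[K] M) :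
    ∃ r : A → M, T = ∑ a, AddMonoidAlgebra.single a 1 ⊗ₜ r a := by
  induction T with
  | zero => exact ⟨0, by simp⟩
  | tmul x m =>
    refine ⟨fun a => x.coeff a • m, ?_⟩
    simp_rw [TensorProduct.tmul_smul, TensorProduct.smul_tmul', ← TensorProduct.sum_tmul]
    congr 1
    ext b
    simp
  | add S T hS hT =>
    obtain ⟨r, rfl⟩ := hS
    obtain ⟨s, rfl⟩ := hT
    exact ⟨r + s, by simp [TensorProduct.tmul_add, Finset.sum_add_distrib]⟩

/-! ### Symmetry of twists in characteristic `p` -/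

section GroupAlgebra

variable {p : ℕ} [Fact p.Prime] {n : ℕ} {K : Type*} [Field K] [CharP K p]
  {A : Type*} [AddCommGroup A]

open AddMonoidAlgebra

instance AddMonoidAlgebra.instCharP : CharP (AddMonoidAlgebra K A) p :=
  charP_of_injective_algebraMap (algebraMap K (AddMonoidAlgebra K A)).injective p

/-- The `pⁿ`-th power map is additive in characteristic `p` and sends every element of `A` to `1`.
It follows that units are detected by `ε` and that idempotents are scalars. -/
theorem AddMonoidAlgebra.pow_eq_algebraMap_counit (hA : ∀ a : A, p ^ n • a = 0)
    (u : AddMonoidAlgebra K A) :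
    u ^ p ^ n = algebraMap K _ (Coalgebra.counit (R := K) u ^ p ^ n) := by
  induction u using AddMonoidAlgebra.induction_linear with
  | zero => simp [(Fact.out : p.Prime).ne_zero]
  | add u v hu hv => rw [add_pow_char_pow, hu, hv, map_add, add_pow_char_pow, map_add]
  | single a c =>
    rw [AddMonoidAlgebra.single_pow, hA, AddMonoidAlgebra.counit_single]
    simp

theorem AddMonoidAlgebra.isUnit_of_counit_ne_zero (hA : ∀ a : A, p ^ n • a = 0)
    {u : AddMonoidAlgebra K A} (hu : Coalgebra.counit (R := K) u ≠ 0) : IsUnit u := by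
  refine (isUnit_pow_iff (pow_ne_zero n (Fact.out : p.Prime).ne_zero)).mp ?_
  rw [pow_eq_algebraMap_counit hA]
  exact (IsUnit.mk0 _ (pow_ne_zero _ hu)).map _

theorem AddMonoidAlgebra.exists_eq_algebraMap_of_isIdempotentElem (hA : ∀ a : A, p ^ n • a = 0)
    {u : AddMonoidAlgebra K A} (hu : IsIdempotentElem u) : ∃ c, u = algebraMap K _ c := by
  refine ⟨_, Eq.trans ?_ (pow_eq_algebraMap_counit hA u)⟩
  exact (hu.pow_eq (pow_ne_zero n (Fact.out : p.Prime).ne_zero)).symm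

variable [Finite A]

/-- In characteristic `p`, every twist for the group algebra of a finite abelian `p`-group is
symmetric. -/
theorem twist_symmetric (hA : ∀ a : A, p ^ n • a = 0) (J : twistGroup K (AddMonoidAlgebra K A)) :
    TensorProduct.comm K _ _ (J : (AddMonoidAlgebra K A ⊗[K] AddMonoidAlgebra K A)ˣ).val =
      (J : (AddMonoidAlgebra K A ⊗[K] AddMonoidAlgebra K A)ˣ).val := by
  classical
  cases nonempty_fintype A
  -- The points `x` and `y` are two independent generic points, recorded by the factors of `A × A`,
  -- and `z` is a third, carried by the coefficient ring `K[A]`.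
  let x : AddMonoidAlgebra K A →ₐ[K] AddMonoidAlgebra (AddMonoidAlgebra K A) (A × A) :=
      AddMonoidAlgebra.lift K _ A
    ((AddMonoidAlgebra.of (AddMonoidAlgebra K A) (A × A)).comp
      (AddMonoidHom.toMultiplicative (AddMonoidHom.inl A A)))
  let y : AddMonoidAlgebra K A →ₐ[K] AddMonoidAlgebra (AddMonoidAlgebra K A) (A × A) :=
      AddMonoidAlgebra.lift K _ A
    ((AddMonoidAlgebra.of (AddMonoidAlgebra K A) (A × A)).comp
      (AddMonoidHom.toMultiplicative (AddMonoidHom.inr A A)))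
  let z : AddMonoidAlgebra K A →ₐ[K] AddMonoidAlgebra (AddMonoidAlgebra K A) (A × A) :=
      AddMonoidAlgebra.singleZeroAlgHom
  have hx (a : A) : x (single a 1) = single (a, 0) 1 := by simp [x]
  have hy (a : A) : y (single a 1) = single (0, a) 1 := by simp [y]
  have hxy (a : A) : pointMul x y (single a 1) = single (a, a) 1 := by
    simp [pointMul, hx, hy, single_mul_single]
  have hz (u : AddMonoidAlgebra K A) : z u = single 0 u := rfl
  obtain ⟨r, hr⟩ := exists_eq_sum_single_tmul
    (swapQuotient (J : (AddMonoidAlgebra K A ⊗[K] AddMonoidAlgebra K A)ˣ)).val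
  have key := congrArg Units.val (evalPoints_pointMul_div_swap J x y z)
  simp only [← evalPoints_swapQuotient, Units.val_mul, coe_evalPoints, hr, map_sum,
    Algebra.TensorProduct.productMap_apply_tmul, hx, hy, hz, hxy, single_mul_single,
    Finset.sum_mul_sum, one_mul, add_zero, zero_add, Prod.mk_add_mk] at key
  -- Multiplicativity reads `∑ r a · (a, a) = ∑ r a r b · (a, b)`; the coefficient at `(a, a)` gives
  -- idempotence.
  have hid (a : A) : IsIdempotentElem (r a) := by
    have := congrArg (fun u : AddMonoidAlgebra (AddMonoidAlgebra K A) (A × A) => u.coeff (a, a)) key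
    have h : r a = r a * r a := by
      simpa [Finsupp.single_apply, Finset.sum_ite, Prod.ext_iff, ite_and, eq_comm] using this
    exact h.symm
  choose c hc using fun a => exists_eq_algebraMap_of_isIdempotentElem hA (hid a)
  have hw : (swapQuotient (J : (AddMonoidAlgebra K A ⊗[K] AddMonoidAlgebra K A)ˣ)).val =
      (∑ a, single a (c a)) ⊗ₜ 1 := by
    rw [hr, TensorProduct.sum_tmul]
    refine Finset.sum_congr rfl fun a _ => ?_
    rw [hc, Algebra.algebraMap_eq_smul_one, TensorProduct.tmul_smul, TensorProduct.smul_tmul']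
    simp
  have hcomm : ∀ T : AddMonoidAlgebra K A ⊗[K] AddMonoidAlgebra K A,
      counitRight K _ (Algebra.TensorProduct.comm K _ _ T) = counitLeft K _ T := by
    intro T
    induction T with
    | zero => simp
    | tmul a b => simp [counitRight, counitLeft]
    | add S T hS hT => simp only [map_add, hS, hT]
  have hmul : (swapQuotient (J : (AddMonoidAlgebra K A ⊗[K] AddMonoidAlgebra K A)ˣ)).val *
      Algebra.TensorProduct.comm K _ _
        (J : (AddMonoidAlgebra K A ⊗[K] AddMonoidAlgebra K A)ˣ).val =
      (J : (AddMonoidAlgebra K A ⊗[K] AddMonoidAlgebra K A)ˣ).val :=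
    congrArg Units.val (div_mul_cancel
      (J : (AddMonoidAlgebra K A ⊗[K] AddMonoidAlgebra K A)ˣ) _)
  -- The quotient now has the form `u ⊗ 1`. Both counit normalizations of `J` make its image under
  -- `id ⊗ ε` equal to `1`, so `u = 1`.
  have hone : (∑ a, single a (c a) : AddMonoidAlgebra K A) = 1 := by
    have := congrArg (counitRight K _) hmul
    rw [map_mul, hcomm, J.2.2.1, J.2.2.2, mul_one, hw] at this
    simpa [counitRight] using this
  rw [hw, hone, ← Algebra.TensorProduct.one_def, one_mul] at hmul
  exact hmul

end GroupAlgebra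

/-! ### Trivialization over a separably closed field -/

section Splitting

open AddMonoidAlgebra

theorem AddMonoidAlgebra.tensor_induction {K A : Type*} [CommRing K]
    {P : AddMonoidAlgebra K A ⊗[K] AddMonoidAlgebra K A → Prop} (zero : P 0)
    (add : ∀ S T, P S → P T → P (S + T))
    (smul_single : ∀ (c : K) (a b : A), P (c • (single a 1 ⊗ₜ single b 1)))
    (T : AddMonoidAlgebra K A ⊗[K] AddMonoidAlgebra K A) : P T := by
  induction T with
  | zero => exact zero
  | add S T hS hT => exact add S T hS hT
  | tmul x y =>
    induction x using AddMonoidAlgebra.induction_linear with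
    | zero => simpa using zero
    | add u v hu hv => rw [TensorProduct.add_tmul]; exact add _ _ hu hv
    | single a c =>
      induction y using AddMonoidAlgebra.induction_linear with
      | zero => simpa using zero
      | add u v hu hv => rw [TensorProduct.tmul_add]; exact add _ _ hu hv
      | single b d =>
        have := smul_single (c * d) a b
        rw [mul_smul, ← TensorProduct.tmul_smul, TensorProduct.smul_tmul'] at this
        simpa using this

variable {K : Type*} [Field K] {A : Type*}

variable (K) in
/-- The functional that reads off the coefficient of `a`. -/
def coeffFunctional (a : A) : AddMonoidAlgebra K A →ₗ[K] K :=
  Finsupp.lapply a ∘ₗ (coeffLinearEquiv K).toLinearMap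

@[simp] theorem coeffFunctional_apply (a : A) (u : AddMonoidAlgebra K A) :
    coeffFunctional K a u = u.coeff a := rfl

theorem functional_eq_sum [Fintype A] (f : AddMonoidAlgebra K A →ₗ[K] K) :
    f = ∑ a, f (single a 1) • coeffFunctional K a := by
  classical
  ext b
  simp [Finsupp.single_apply]

theorem counit_eq_sum_coeffFunctional [Fintype A] :
    (Coalgebra.counit : AddMonoidAlgebra K A →ₗ[K] K) = ∑ a, coeffFunctional K a := by
  rw [functional_eq_sum Coalgebra.counit]
  simp

theorem comul_single_eq_smul (a : A) (t : K) :
    Coalgebra.comul (R := K) (single a t : AddMonoidAlgebra K A) =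
      t • (single a 1 ⊗ₜ single a 1) := by
  have : (single a t : AddMonoidAlgebra K A) = t • single a 1 := by simp
  rw [this, map_smul]
  simp

variable [AddCommGroup A]

theorem tensorBaseChange_smul_single {L : Type*} [Field L] [Algebra K L] (c : K) (a b : A) :
    tensorBaseChange A K L (c • (single a 1 ⊗ₜ single b 1)) =
      algebraMap K L c • (single a 1 ⊗ₜ single b 1) := by
  rw [map_smul, algebraMap_smul]
  simp [tensorBaseChange]

theorem coeffFunctional_eq_translate (a : A) :
    coeffFunctional K a =
      coeffFunctional K 0 ∘ₗ LinearMap.mulRight K (single (-a) 1 : AddMonoidAlgebra K A) := by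
  refine LinearMap.ext fun u => ?_
  simp

theorem translate_mem {W : Submodule K (AddMonoidAlgebra K A →ₗ[K] K)}
    {v : AddMonoidAlgebra K A →ₗ[K] K}
    (hv : ∀ a, v ∘ₗ LinearMap.mulRight K (single a 1) ∈ W) (s : AddMonoidAlgebra K A) :
    v ∘ₗ LinearMap.mulRight K s ∈ W := by
  induction s using AddMonoidAlgebra.induction_linear with
  | zero =>
    rw [LinearMap.mulRight_zero_eq_zero, LinearMap.comp_zero]
    exact zero_mem _
  | add s t hs ht =>
    have : LinearMap.mulRight K (s + t) = LinearMap.mulRight K s + LinearMap.mulRight K t := by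
      ext; simp [mul_add]
    rw [this, LinearMap.comp_add]
    exact add_mem hs ht
  | single a c =>
    have : LinearMap.mulRight K (single a c : AddMonoidAlgebra K A) =
        c • LinearMap.mulRight K (single a 1) := by
      ext; simp
    rw [this, LinearMap.comp_smul]
    exact Submodule.smul_mem _ _ (hv a)

variable {p : ℕ} [Fact p.Prime] {n : ℕ} [CharP K p] [Fintype A]

/-- This is the Frobenius property of `K[A]`: its dual is generated as a `K[A]`-module by the
coefficient functional at `0`, whose translate by `-a` is the one at `a`. -/
theorem exists_eq_coeffFunctional_translate (f : AddMonoidAlgebra K A →ₗ[K] K) :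
    ∃ u : AddMonoidAlgebra K A, f = coeffFunctional K 0 ∘ₗ LinearMap.mulRight K u ∧
      Coalgebra.counit (R := K) u = ∑ a, f (single a 1) := by
  refine ⟨∑ a, f (single a 1) • single (-a) 1, ?_, by simp⟩
  refine (functional_eq_sum f).trans (LinearMap.ext fun h => ?_)
  simp only [LinearMap.sum_apply, LinearMap.smul_apply, LinearMap.comp_apply,
    LinearMap.mulRight_apply, Finset.mul_sum, map_sum, mul_smul_comm, map_smul]
  exact Finset.sum_congr rfl fun a _ =>
    congrArg _ (LinearMap.congr_fun (coeffFunctional_eq_translate a) h)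

variable (J : twistGroup K (AddMonoidAlgebra K A))
  [SymmetricTwist J]

namespace TwistedDual

instance : Nontrivial (TwistedDual J) := by
  refine ⟨0, 1, fun h => ?_⟩
  have h1 := congrArg (fun f => (of J).symm f 1) h
  change (0 : K) = Coalgebra.counit (R := K) (1 : AddMonoidAlgebra K A) at h1
  rw [Bialgebra.counit_one] at h1
  exact zero_ne_one h1

instance : Module.Finite K (TwistedDual J) :=
  inferInstanceAs (Module.Finite K (AddMonoidAlgebra K A →ₗ[K] K))

/-- The twisted dual of the group algebra of a `p`-group is spanned by `p`-th powers. -/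
theorem span_pow_eq_top (hA : ∀ a : A, p ^ n • a = 0) :
    Submodule.span K (Set.range fun f : TwistedDual J => f ^ p) = ⊤ := by
  have : CharP (TwistedDual J) p :=
    charP_of_injective_algebraMap (algebraMap K (TwistedDual J)).injective p
  -- The functional `v` is the twisted `p`-th power of the coefficient functional at `0`.
  -- Translations are algebra maps, so the translates of `v` are again `p`-th powers, and it
  -- suffices that `v` generates the dual over `K[A]`.
  let v : AddMonoidAlgebra K A →ₗ[K] K := (of J).symm (of J (coeffFunctional K 0) ^ p)
  have hv (a : A) : v ∘ₗ LinearMap.mulRight K (single (-a) 1) =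
      (of J).symm (of J (coeffFunctional K a) ^ p) := by
    have := map_pow (translate J (isGroupLikeElem_single_one (R := K) (A := K) (-a)))
      (of J (coeffFunctional K 0)) p
    rw [translate_of, ← coeffFunctional_eq_translate] at this
    rw [← this]
    rfl
  -- The coefficient functionals sum to the counit, which is the unit of the twisted dual; Frobenius
  -- is additive, so their `p`-th powers also sum to it. Evaluating at `1` gives the claim. Hence
  -- the `u` representing `v` has `ε(u) = 1` and is invertible.
  have hsum : ∑ a, v (single a 1) = 1 := by
    have h1 : ∑ a, of J (coeffFunctional K a) ^ p = of J (Coalgebra.counit) := by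
      rw [← sum_pow_char, ← map_sum, ← counit_eq_sum_coeffFunctional, of_counit, one_pow]
    have h2 := LinearMap.congr_fun (congrArg (of J).symm h1) 1
    rw [map_sum, LinearEquiv.symm_apply_apply, LinearMap.sum_apply, Bialgebra.counit_one] at h2
    rw [← Equiv.sum_comp (Equiv.neg A) fun a => v (single a 1)]
    refine Eq.trans (Finset.sum_congr rfl fun a _ => ?_) h2
    rw [← hv]
    simp
  obtain ⟨u, hu, hu'⟩ := exists_eq_coeffFunctional_translate v
  rw [hsum] at hu'
  obtain ⟨w, hw⟩ := (isUnit_of_counit_ne_zero hA (hu' ▸ one_ne_zero)).exists_right_inv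
  rw [eq_top_iff]
  rintro f -
  obtain ⟨t, ht, -⟩ := exists_eq_coeffFunctional_translate ((of J).symm f)
  have hf : (of J).symm f = v ∘ₗ LinearMap.mulRight K (w * t) := by
    rw [ht, hu]
    refine LinearMap.ext fun h => ?_
    simp only [LinearMap.comp_apply, LinearMap.mulRight_apply]
    congr 1
    linear_combination (-(h * t)) * hw
  have hmem := translate_mem (v := v)
    (W := (Submodule.span K (Set.range fun f : TwistedDual J => f ^ p)).comap (of J).toLinearMap)
    (fun a => by
      rw [← neg_neg a, hv]
      exact Submodule.subset_span ⟨_, rfl⟩) (w * t)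
  rw [← hf] at hmem
  exact hmem

/-- In characteristic `p` every derivation kills `p`-th powers, and these span, so the Kähler
differentials vanish. -/
theorem formallyUnramified (hA : ∀ a : A, p ^ n • a = 0) :
    Algebra.FormallyUnramified K (TwistedDual J) := by
  have : CharP (TwistedDual J) p :=
    charP_of_injective_algebraMap (algebraMap K (TwistedDual J)).injective p
  refine ⟨?_⟩
  rw [← Submodule.subsingleton_iff (TwistedDual J), ← subsingleton_iff_bot_eq_top,
    ← KaehlerDifferential.span_range_derivation, eq_comm, Submodule.span_eq_bot]
  rintro _ ⟨f, rfl⟩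
  have hf : f ∈ Submodule.span K (Set.range fun f : TwistedDual J => f ^ p) :=
    (span_pow_eq_top J hA).symm ▸ Submodule.mem_top
  induction hf using Submodule.span_induction with
  | mem _ h =>
    obtain ⟨g, rfl⟩ := h
    rw [Derivation.leibniz_pow, ← Nat.cast_smul_eq_nsmul (TwistedDual J), CharP.cast_eq_zero,
      zero_smul]
  | zero => exact map_zero _
  | add _ _ _ _ h1 h2 => rw [map_add, h1, h2, add_zero]
  | smul c _ _ h => rw [Derivation.map_smul, h, smul_zero]

/-- The twisted dual has a point over every separably closed extension. -/
theorem nonempty_algHom (hA : ∀ a : A, p ^ n • a = 0) (L : Type*) [Field L] [Algebra K L]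
    [IsSepClosed L] : Nonempty (TwistedDual J →ₐ[K] L) := by
  -- The residue field at any maximal ideal is finite and unramified over `K`, hence separable, so
  -- it embeds into `L`.
  obtain ⟨m, hm⟩ := Ideal.exists_maximal (TwistedDual J)
  let : Field (TwistedDual J ⧸ m) := Ideal.Quotient.field m
  have := formallyUnramified J hA
  have : Algebra.FormallyUnramified K (TwistedDual J ⧸ m) :=
    Algebra.FormallyUnramified.of_surjective (Ideal.Quotient.mkₐ K m)
      (Ideal.Quotient.mkₐ_surjective K m)
  have : Algebra.IsSeparable K (TwistedDual J ⧸ m) :=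
    Algebra.FormallyUnramified.isSeparable K _
  exact ⟨(IsSepClosed.lift : (TwistedDual J ⧸ m) →ₐ[K] L).comp (Ideal.Quotient.mkₐ K m)⟩

end TwistedDual

/-- A point of the twisted dual over `L` trivializes the twist over `L`. -/
theorem tensorBaseChange_mul_comul_of_algHom {L : Type*} [Field L] [Algebra K L]
    (φ : TwistedDual J →ₐ[K] L) :
    tensorBaseChange A K L (J : (AddMonoidAlgebra K A ⊗[K] AddMonoidAlgebra K A)ˣ) *
      Coalgebra.comul (R := L) (∑ a, single a (φ (TwistedDual.of J (coeffFunctional K a)))) =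
    (∑ a, single a (φ (TwistedDual.of J (coeffFunctional K a)))) ⊗ₜ[L]
      (∑ a, single a (φ (TwistedDual.of J (coeffFunctional K a)))) := by
  classical
  -- This identity is linear in `T`, so it can be checked on pairs of group elements.
  -- Multiplicativity of `φ` is needed only afterwards, for `T = J`.
  have key (T : AddMonoidAlgebra K A ⊗[K] AddMonoidAlgebra K A) : tensorBaseChange A K L T *
      Coalgebra.comul (R := L) (∑ a, single a (φ (TwistedDual.of J (coeffFunctional K a)))) =
      ∑ b, ∑ c, φ (TwistedDual.of J (twistedMul T (coeffFunctional K b) (coeffFunctional K c))) •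
        (single b 1 ⊗ₜ[L] single c 1) := by
    induction T using AddMonoidAlgebra.tensor_induction with
    | zero => simp [twistedMul_zero_twist]
    | add S T hS hT =>
      simp only [map_add, add_mul, hS, hT, twistedMul_add_twist, add_smul, Finset.sum_add_distrib]
    | smul_single t a₁ a₂ =>
      have h (b c : A) : twistedMul (single a₁ 1 ⊗ₜ single a₂ 1) (coeffFunctional K b)
          (coeffFunctional K c) = ∑ a, (if a + a₂ = c then if a + a₁ = b then (1 : K) else 0 else 0) •
            coeffFunctional K a := by
        refine (functional_eq_sum _).trans (Finset.sum_congr rfl fun a _ => ?_)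
        congr 1
        rw [twistedMul_apply]
        simp [Finsupp.single_apply]
      rw [tensorBaseChange_smul_single, map_sum, Finset.mul_sum]
      simp_rw [twistedMul_smul_twist, h, map_smul, map_sum, map_smul, Finset.smul_sum,
        Finset.sum_smul]
      rw [Finset.sum_congr rfl fun b _ => Finset.sum_comm, Finset.sum_comm]
      refine Finset.sum_congr rfl fun a _ => ?_
      have hc : Coalgebra.comul (R := L) (single a (φ (TwistedDual.of J (coeffFunctional K a))) :
          AddMonoidAlgebra L A) =
            φ (TwistedDual.of J (coeffFunctional K a)) • (single a 1 ⊗ₜ single a 1) :=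
        comul_single_eq_smul _ _
      simp only [ite_smul, mul_ite, mul_zero, one_smul, zero_smul, Finset.sum_ite_eq,
        Finset.mem_univ, if_true, hc, smul_mul_smul_comm, Algebra.TensorProduct.tmul_mul_tmul,
        single_mul_single, mul_one, Algebra.smul_def t, add_comm a]
  rw [key, TensorProduct.sum_tmul]
  refine Finset.sum_congr rfl fun b _ => ?_
  rw [TensorProduct.tmul_sum]
  refine Finset.sum_congr rfl fun c _ => ?_
  rw [← TwistedDual.of_mul, map_mul, mul_smul, ← TensorProduct.tmul_smul, TensorProduct.smul_tmul']
  simp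

/-- Every twist for the group algebra of a finite abelian `p`-group is trivial over a separably
closed extension of the ground field. -/
theorem exists_trivialization (hA : ∀ a : A, p ^ n • a = 0) (L : Type*) [Field L] [Algebra K L]
    [IsSepClosed L] (J : twistGroup K (AddMonoidAlgebra K A)) :
    ∃ x : (AddMonoidAlgebra L A)ˣ,
      tensorBaseChange A K L (J : (AddMonoidAlgebra K A ⊗[K] AddMonoidAlgebra K A)ˣ) *
        Coalgebra.comul (R := L) (x : AddMonoidAlgebra L A) =
      (x : AddMonoidAlgebra L A) ⊗ₜ[L] (x : AddMonoidAlgebra L A) := by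
  have : SymmetricTwist J := ⟨twist_symmetric hA J⟩
  obtain ⟨φ⟩ := TwistedDual.nonempty_algHom J hA L
  have : CharP L p := charP_of_injective_algebraMap (algebraMap K L).injective p
  have hu : IsUnit (∑ a, single a (φ (TwistedDual.of J (coeffFunctional K a))) :
      AddMonoidAlgebra L A) := by
    refine isUnit_of_counit_ne_zero hA ?_
    have h : Coalgebra.counit (R := L) (∑ a, single a (φ (TwistedDual.of J (coeffFunctional K a))) :
        AddMonoidAlgebra L A) = φ 1 := by
      have hc : φ 1 = ∑ a, φ (TwistedDual.of J (coeffFunctional K a)) := by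
        rw [← TwistedDual.of_counit, counit_eq_sum_coeffFunctional, map_sum, map_sum]
      rw [hc, map_sum]
      exact Finset.sum_congr rfl fun a _ => by simp
    rw [h, map_one]
    exact one_ne_zero
  exact ⟨hu.unit, tensorBaseChange_mul_comul_of_algHom J φ⟩

end Splitting

/-! ### The map `℘` on truncated Witt vectors -/

section Witt

variable {p : ℕ} [Fact p.Prime] {n : ℕ}

section Functoriality

variable {R S T : Type*} [CommRing R] [CommRing S] [CommRing T]

theorem coeff_wittMap (f : R →+* S) (x : TruncatedWittVector p n R) (i : Fin n) :
    (wittMap f x).coeff i = f (x.coeff i) :=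
  TruncatedWittVector.coeff_mk _ _

theorem wittMap_truncate (f : R →+* S) (x : WittVector p R) :
    wittMap f (WittVector.truncate n x) = WittVector.truncate n (WittVector.map f x) := by
  ext i
  rw [coeff_wittMap, WittVector.coeff_truncate, WittVector.coeff_truncate, WittVector.map_coeff]

theorem wittMap_wittMap (f : R →+* S) (g : S →+* T) (x : TruncatedWittVector p n R) :
    wittMap g (wittMap f x) = wittMap (g.comp f) x := by
  ext i
  simp only [coeff_wittMap, RingHom.comp_apply]

theorem wittMap_injective {f : R →+* S} (hf : Function.Injective f) :
    Function.Injective (wittMap f : TruncatedWittVector p n R →+* TruncatedWittVector p n S) := by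
  intro x y h
  ext i
  apply hf
  rw [← coeff_wittMap, ← coeff_wittMap, h]

variable [CharP R p] [CharP S p]

theorem wittP_apply (x : TruncatedWittVector p n R) :
    wittP p n R x = wittMap (frobenius R p) x - x := rfl

theorem wittP_truncate (x : WittVector p R) :
    wittP p n R (WittVector.truncate n x) =
      WittVector.truncate n (WittVector.frobenius x - x) := by
  rw [wittP_apply, wittMap_truncate, map_sub, WittVector.frobenius_eq_map_frobenius]

theorem wittP_wittMap (f : R →+* S) (x : TruncatedWittVector p n R) :
    wittP p n S (wittMap f x) = wittMap f (wittP p n R x) := by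
  have e : (frobenius S p).comp f = f.comp (frobenius R p) :=
    RingHom.ext fun r => (f.map_frobenius p r).symm
  rw [wittP_apply, wittP_apply, map_sub, wittMap_wittMap, wittMap_wittMap, e]

end Functoriality

section Field

variable {L : Type*} [Field L] [CharP L p]

variable (p n L) in
/-- The inclusion `ℤ / pⁿ = W_n(𝔽_p) → W_n(L)`. -/
def zmodToWitt : ZMod (p ^ n) →+* TruncatedWittVector p n L :=
  (wittMap (ZMod.castHom dvd_rfl L)).comp (TruncatedWittVector.zmodEquivTrunc p n).toRingHom

theorem zmodToWitt_injective : Function.Injective (zmodToWitt p n L) :=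
  (wittMap_injective (ZMod.castHom (dvd_refl p) L).injective).comp
    (TruncatedWittVector.zmodEquivTrunc p n).injective

theorem zmodToWitt_eq_natCast (k : ZMod (p ^ n)) :
    zmodToWitt p n L k = (k.val : TruncatedWittVector p n L) := by
  conv_lhs => rw [← ZMod.natCast_zmod_val k]
  rw [map_natCast]

/-- A Witt vector fixed by Frobenius has all coordinates satisfying `c ^ p = c`, hence in `𝔽_p`, and
`W_n(𝔽_p) = ℤ/pⁿ`. -/
theorem wittP_eq_zero_iff {y : TruncatedWittVector p n L} :
    wittP p n L y = 0 ↔ ∃ k, zmodToWitt p n L k = y := by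
  constructor
  · intro h
    rw [wittP_apply, sub_eq_zero] at h
    have hi (i : Fin n) : ∃ c : ZMod p, ZMod.castHom dvd_rfl L c = y.coeff i := by
      have h1 := congrArg (TruncatedWittVector.coeff i) h
      rw [coeff_wittMap, frobenius_def] at h1
      have h2 := (Subfield.mem_bot_iff_pow_eq_self L p).mpr h1
      rwa [← ZMod.fieldRange_castHom_eq_bot p] at h2
    choose c hc using hi
    obtain ⟨k, hk⟩ := (TruncatedWittVector.zmodEquivTrunc p n).surjective
      (TruncatedWittVector.mk p c)
    refine ⟨k, ?_⟩
    rw [zmodToWitt, RingHom.comp_apply, RingEquiv.toRingHom_eq_coe, RingEquiv.coe_toRingHom, hk]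
    ext i
    rw [coeff_wittMap, TruncatedWittVector.coeff_mk, hc]
  · rintro ⟨k, rfl⟩
    rw [zmodToWitt_eq_natCast, wittP_apply, map_natCast, sub_self]

theorem wittP_surjective_of_isSepClosed [IsSepClosed L] :
    Function.Surjective (wittP p n L) := by
  -- The equation is solved modulo `Vᵏ` by induction. Adding `Vᵏ[c]` to `y` changes the error to
  -- `Vᵏ(F[c] - [c] + z)`, because `F` and `V` commute. Its leading coordinate `c ^ p - c + z₀` can
  -- be made zero since this polynomial in `c` is separable.
  have key (w : WittVector p L) (k : ℕ) : ∃ y z : WittVector p L,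
      WittVector.frobenius y - y - w = WittVector.verschiebung^[k] z := by
    induction k with
    | zero => exact ⟨0, -w, by simp⟩
    | succ k ih =>
      obtain ⟨y, z, hz⟩ := ih
      obtain ⟨c, hc⟩ := IsSepClosed.exists_root_C_mul_X_pow_add_C_mul_X_add_C' p p
        1 (-1) (z.coeff 0) dvd_rfl (Fact.out : p.Prime).two_le (neg_ne_zero.mpr one_ne_zero)
      let u := WittVector.frobenius (WittVector.teichmuller p c) - WittVector.teichmuller p c + z
      have hu : u.coeff 0 = 0 := by
        have : u.coeff 0 = WittVector.constantCoeff u := rfl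
        rw [this, map_add, map_sub]
        simp only [WittVector.constantCoeff_apply, WittVector.coeff_frobenius_charP,
          WittVector.teichmuller_coeff_zero]
        linear_combination hc
      refine ⟨y + WittVector.verschiebung^[k] (WittVector.teichmuller p c), u.shift 1, ?_⟩
      have hs : WittVector.verschiebung (u.shift 1) = u :=
        (WittVector.eq_iterate_verschiebung (n := 1) (by simpa using hu)).symm
      rw [Function.iterate_succ_apply, hs, iterate_map_add, iterate_map_sub, ← hz, map_add,
        (WittVector.verschiebung_frobenius_comm.iterate_left k).eq]
      ring
  intro w
  obtain ⟨w, rfl⟩ := WittVector.truncate_surjective p n L w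
  obtain ⟨y, z, h⟩ := key w n
  refine ⟨WittVector.truncate n y, ?_⟩
  rw [wittP_truncate, ← sub_eq_zero, ← map_sub, h]
  ext i
  rw [WittVector.coeff_truncate, WittVector.iterate_verschiebung_coeff_eq_zero _ i.2,
    TruncatedWittVector.coeff_zero]

end Field

end Witt

universe u

/-! ### Galois orbits and Artin-Schreier-Witt theory -/

section Galois

/-- An additive character of the Galois group that is trivial on the elements fixing some finite
set. -/
def IsFiniteGaloisHom {K L M : Type*} [Field K] [Field L] [Algebra K L] [AddCommGroup M]
    (f : Gal(L/K) → M) : Prop :=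
  (∀ g h, f (g * h) = f g + f h) ∧
    ∃ s : Set L, s.Finite ∧ ∀ g : Gal(L/K), (∀ x ∈ s, g x = x) → f g = 0

section

variable {K : Type*} {L : Type u} {M : Type*} [Field K] [Field L] [Algebra K L] [IsGalois K L]
  [AddCommGroup M]

theorem exists_algebraMap_eq_of_forall_fixed {x : L} (hx : ∀ g : Gal(L/K), g x = x) :
    ∃ c, algebraMap K L c = x :=
  (InfiniteGalois.mem_bot_iff_fixed x).mpr hx

/-- A finite Galois orbit with sum one on which an additive character of the Galois group becomes
a coboundary. -/
theorem IsFiniteGaloisHom.exists_orbit {f : Gal(L/K) → M} (hf : IsFiniteGaloisHom f) :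
    ∃ (Q : Type u) (_ : Fintype Q) (act : Gal(L/K) → Q ≃ Q) (t : Q → L) (c : Q → M),
      (∀ g q, g (t q) = t (act g q)) ∧ (∀ g q, c (act g q) = f g + c q) ∧ ∑ q, t q = 1 := by
  obtain ⟨hadd, s, hs, hfs⟩ := hf
  have := hs.to_subtype
  -- The character `f` factors through the Galois group of `E`, so its value on a lift `σ q` is
  -- independent of the lift. The elements `t q` are the conjugates of an element of trace one.
  let E := FiniteGaloisIntermediateField.adjoin K s
  obtain ⟨θ, hθ⟩ := Algebra.trace_surjective K E 1
  let σ := Function.surjInv (AlgEquiv.restrictNormalHom_surjective (F := K) (K₁ := E) L)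
  have hσ (q : Gal(E/K)) : AlgEquiv.restrictNormalHom E (σ q) = q := Function.surjInv_eq _ q
  refine ⟨Gal(E/K), inferInstance, fun g => Equiv.mulLeft (AlgEquiv.restrictNormalHom E g),
    fun q => (q θ : L), fun q => f (σ q), fun g q => ?_, fun g q => ?_, ?_⟩
  · exact (AlgEquiv.restrictNormal_commutes g E (q θ)).symm
  · have h1 : f (σ (AlgEquiv.restrictNormalHom E g * q)) = f (g * σ q) := by
      have hfix (h : Gal(L/K)) (hh : AlgEquiv.restrictNormalHom E h = 1) : f h = 0 := by
        refine hfs h fun x hx => ?_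
        have := AlgEquiv.restrictNormal_commutes h E
          ⟨x, FiniteGaloisIntermediateField.subset_adjoin K s hx⟩
        rw [show h.restrictNormal E = 1 from hh] at this
        exact this.symm
      have h2 := hadd (g * σ q) ((g * σ q)⁻¹ * σ (AlgEquiv.restrictNormalHom E g * q))
      have h3 := hfix ((g * σ q)⁻¹ * σ (AlgEquiv.restrictNormalHom E g * q))
        (by rw [map_mul, map_inv, map_mul, hσ, hσ, inv_mul_cancel])
      rwa [h3, add_zero, mul_inv_cancel_left] at h2
    exact h1.trans (hadd _ _)
  · have := trace_eq_sum_automorphisms (K := K) θ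
    rw [hθ, map_one] at this
    have h1 := congrArg (algebraMap E L) this
    rw [map_one, map_sum] at h1
    exact h1.symm

end

section Witt

variable {p : ℕ} [Fact p.Prime] {n : ℕ} {K : Type*} [Field K]

local notation "Kˢ" => SeparableClosure K

theorem exists_wittMap_eq_of_forall_fixed {y : TruncatedWittVector p n Kˢ}
    (hy : ∀ g : Gal(Kˢ/K), wittMap (g : Kˢ →+* Kˢ) y = y) :
    ∃ w, wittMap (algebraMap K Kˢ) w = y := by
  have h (i : Fin n) : ∃ c, algebraMap K Kˢ c = y.coeff i :=
    exists_algebraMap_eq_of_forall_fixed fun g => by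
      conv_rhs => rw [← hy g]
      rw [coeff_wittMap]
      rfl
  choose c hc using h
  refine ⟨TruncatedWittVector.mk p c, ?_⟩
  ext i
  rw [coeff_wittMap, TruncatedWittVector.coeff_mk, hc]

theorem wittMap_algebraMap_fixed (g : Gal(Kˢ/K)) (w : TruncatedWittVector p n K) :
    wittMap (g : Kˢ →+* Kˢ) (wittMap (algebraMap K Kˢ) w) = wittMap (algebraMap K Kˢ) w := by
  rw [wittMap_wittMap]
  have e : (g : Kˢ →+* Kˢ).comp (algebraMap K Kˢ) = algebraMap K Kˢ := RingHom.ext g.commutes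
  rw [e]

variable [CharP K p]

theorem IsArtinSchreierWitt.add {c c' : WittModP p n K} {κ κ' : Gal(Kˢ/K) → ZMod (p ^ n)}
    (h : IsArtinSchreierWitt c κ) (h' : IsArtinSchreierWitt c' κ') :
    IsArtinSchreierWitt (c + c') (κ + κ') := by
  obtain ⟨w, y, rfl, hy, hg⟩ := h
  obtain ⟨w', y', rfl, hy', hg'⟩ := h'
  refine ⟨w + w', y + y', rfl, by rw [map_add, map_add, hy, hy'], fun g => ?_⟩
  have e := hg g
  have e' := hg' g
  rw [← zmodToWitt_eq_natCast] at e e' ⊢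
  rw [Pi.add_apply, map_add (zmodToWitt p n Kˢ), ← e, ← e', map_add]
  ring

theorem IsArtinSchreierWitt.neg {c : WittModP p n K} {κ : Gal(Kˢ/K) → ZMod (p ^ n)}
    (h : IsArtinSchreierWitt c κ) : IsArtinSchreierWitt (-c) (-κ) := by
  obtain ⟨w, y, rfl, hy, hg⟩ := h
  refine ⟨-w, -y, rfl, by rw [map_neg, map_neg, hy], fun g => ?_⟩
  have e := hg g
  rw [← zmodToWitt_eq_natCast] at e ⊢
  rw [Pi.neg_apply, map_neg (zmodToWitt p n Kˢ), ← e, map_neg]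
  ring

theorem isArtinSchreierWitt_zero : IsArtinSchreierWitt (0 : WittModP p n K) 0 :=
  ⟨0, 0, rfl, by rw [map_zero, map_zero], fun g => by simp⟩

/-- If `w = ℘(v)` with `v` over `K`, then `y - v` lies in the kernel `ℤ/pⁿ` of `℘` and is Galois
invariant, so `y` is invariant too. With the converse below and additivity, class and character
determine each other. -/
theorem isArtinSchreierWitt_zero_iff_left {κ : Gal(Kˢ/K) → ZMod (p ^ n)} :
    IsArtinSchreierWitt (0 : WittModP p n K) κ ↔ κ = 0 := by
  refine ⟨?_, fun h => h ▸ isArtinSchreierWitt_zero⟩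
  rintro ⟨w, y, hw, hy, hg⟩
  rw [QuotientAddGroup.eq_zero_iff] at hw
  obtain ⟨v, rfl⟩ := hw
  have h1 : wittP p n Kˢ (y - wittMap (algebraMap K Kˢ) v) = 0 := by
    rw [map_sub, hy, wittP_wittMap, sub_self]
  obtain ⟨k, hk⟩ := wittP_eq_zero_iff.mp h1
  have hy : y = zmodToWitt p n Kˢ k + wittMap (algebraMap K Kˢ) v := by rw [hk, sub_add_cancel]
  funext g
  apply zmodToWitt_injective (L := Kˢ)
  rw [zmodToWitt_eq_natCast, ← hg, hy, map_add, wittMap_algebraMap_fixed, zmodToWitt_eq_natCast,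
    map_natCast, sub_self, Pi.zero_apply, map_zero]

theorem isArtinSchreierWitt_zero_iff_right {c : WittModP p n K} :
    IsArtinSchreierWitt c (0 : Gal(Kˢ/K) → ZMod (p ^ n)) ↔ c = 0 := by
  refine ⟨?_, fun h => h ▸ isArtinSchreierWitt_zero⟩
  rintro ⟨w, y, rfl, hy, hg⟩
  obtain ⟨v, rfl⟩ := exists_wittMap_eq_of_forall_fixed (y := y) fun g => by
    rw [← sub_eq_zero, hg]
    simp
  rw [wittP_wittMap] at hy
  rw [QuotientAddGroup.eq_zero_iff]
  exact ⟨v, wittMap_injective (algebraMap K Kˢ).injective hy⟩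

theorem IsArtinSchreierWitt.congr_left {c c' : WittModP p n K} {κ : Gal(Kˢ/K) → ZMod (p ^ n)}
    (h : IsArtinSchreierWitt c κ) (h' : IsArtinSchreierWitt c' κ) : c = c' := by
  have := h.add h'.neg
  rwa [add_neg_cancel, isArtinSchreierWitt_zero_iff_right, add_neg_eq_zero] at this

theorem IsArtinSchreierWitt.congr_right {c : WittModP p n K} {κ κ' : Gal(Kˢ/K) → ZMod (p ^ n)}
    (h : IsArtinSchreierWitt c κ) (h' : IsArtinSchreierWitt c κ') : κ = κ' := by
  have := h.add h'.neg
  rwa [add_neg_cancel, isArtinSchreierWitt_zero_iff_left, add_neg_eq_zero] at this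

/-- Every class of `W_n(K) / ℘(W_n(K))` has an Artin-Schreier-Witt character. -/
theorem exists_isArtinSchreierWitt_right (c : WittModP p n K) :
    ∃ κ : Gal(Kˢ/K) → ZMod (p ^ n), IsArtinSchreierWitt c κ ∧ IsFiniteGaloisHom κ := by
  obtain ⟨w, rfl⟩ := QuotientAddGroup.mk_surjective c
  obtain ⟨y, hy⟩ := wittP_surjective_of_isSepClosed (wittMap (algebraMap K Kˢ) w)
  have h (g : Gal(Kˢ/K)) : ∃ k, zmodToWitt p n Kˢ k = wittMap (g : Kˢ →+* Kˢ) y - y := by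
    rw [← wittP_eq_zero_iff, map_sub, wittP_wittMap, hy, wittMap_algebraMap_fixed, sub_self]
  choose κ hκ using h
  refine ⟨κ, ⟨w, y, rfl, hy, fun g => by rw [← zmodToWitt_eq_natCast, hκ]⟩, fun g h => ?_,
    Set.range y.coeff, Set.finite_range _, fun g hg => ?_⟩
  · apply zmodToWitt_injective (L := Kˢ)
    have h1 : wittMap ((g * h : Gal(Kˢ/K)) : Kˢ →+* Kˢ) y =
        wittMap (g : Kˢ →+* Kˢ) (wittMap (h : Kˢ →+* Kˢ) y) := by
      rw [wittMap_wittMap]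
      rfl
    have h2 : wittMap (h : Kˢ →+* Kˢ) y = y + zmodToWitt p n Kˢ (κ h) := by rw [hκ]; ring
    rw [map_add, hκ, hκ g, h1, h2, map_add, zmodToWitt_eq_natCast, map_natCast]
    ring
  · apply zmodToWitt_injective (L := Kˢ)
    rw [hκ, map_zero, sub_eq_zero]
    refine TruncatedWittVector.ext fun i => ?_
    rw [coeff_wittMap]
    exact hg _ ⟨i, rfl⟩

/-- Every continuous character of the Galois group is an Artin-Schreier-Witt character. -/
theorem IsFiniteGaloisHom.exists_isArtinSchreierWitt {κ : Gal(Kˢ/K) → ZMod (p ^ n)}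
    (hκ : IsFiniteGaloisHom κ) : ∃ c : WittModP p n K, IsArtinSchreierWitt c κ := by
  obtain ⟨Q, _, act, t, c, ht, hc, hsum⟩ := hκ.exists_orbit
  -- Teichmüller lifts keep the Galois permutation of the `t q`. Their sum need not be `1`, but it
  -- is an invariant unit `u` because its constant coefficient is `1`; dividing by `u` corrects the
  -- average `Y`.
  let τ (q : Q) : TruncatedWittVector p n Kˢ :=
    WittVector.truncate n (WittVector.teichmuller p (t q))
  have hτ (g : Gal(Kˢ/K)) (q : Q) : wittMap (g : Kˢ →+* Kˢ) (τ q) = τ (act g q) := by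
    simp only [τ, wittMap_truncate, WittVector.map_teichmuller, ← ht]
    rfl
  obtain ⟨u, hu⟩ : IsUnit (∑ q, τ q) := by
    simp only [τ, ← map_sum]
    refine IsUnit.map _ (WittVector.isUnit_of_coeff_zero_ne_zero _ ?_)
    rw [← WittVector.constantCoeff_apply, map_sum]
    simp [WittVector.constantCoeff_apply, hsum]
  have hgu (g : Gal(Kˢ/K)) : wittMap (g : Kˢ →+* Kˢ) (u : TruncatedWittVector p n Kˢ) = u := by
    rw [hu, map_sum, ← Equiv.sum_comp (act g) τ]
    exact Finset.sum_congr rfl fun q _ => hτ g q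
  let Y := ∑ q, zmodToWitt p n Kˢ (c q) * τ q
  have hY (g : Gal(Kˢ/K)) : wittMap (g : Kˢ →+* Kˢ) Y = Y - zmodToWitt p n Kˢ (κ g) * u := by
    simp only [Y]
    rw [map_sum, ← Equiv.sum_comp (act g) fun q => zmodToWitt p n Kˢ (c q) * τ q, hu,
      ← Equiv.sum_comp (act g) τ, Finset.mul_sum, ← Finset.sum_sub_distrib]
    refine Finset.sum_congr rfl fun q _ => ?_
    rw [map_mul, hτ, hc, map_add, zmodToWitt_eq_natCast (c q), map_natCast]
    ring
  let y := -(Y * (u⁻¹ : (TruncatedWittVector p n Kˢ)ˣ))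
  have hy (g : Gal(Kˢ/K)) : wittMap (g : Kˢ →+* Kˢ) y = y + zmodToWitt p n Kˢ (κ g) := by
    have h1 : wittMap (g : Kˢ →+* Kˢ) ((u⁻¹ : (TruncatedWittVector p n Kˢ)ˣ) :
        TruncatedWittVector p n Kˢ) = (u⁻¹ : (TruncatedWittVector p n Kˢ)ˣ) := by
      refine eq_comm.mp (Units.inv_eq_of_mul_eq_one_right ?_) 
      conv_lhs => enter [1]; rw [← hgu g]
      rw [← map_mul, Units.mul_inv, map_one]
    simp only [y]
    rw [map_neg, map_mul, h1, hY]
    linear_combination zmodToWitt p n Kˢ (κ g) * u.mul_inv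
  -- The translates of `y` differ from it by elements of `ker ℘`, so `℘(y)` is invariant and
  -- descends to `K`.
  obtain ⟨w, hw⟩ := exists_wittMap_eq_of_forall_fixed (y := wittP p n Kˢ y) fun g => by
    rw [← wittP_wittMap, hy, map_add, wittP_eq_zero_iff.mpr ⟨_, rfl⟩, add_zero]
  exact ⟨w, w, y, rfl, hw.symm, fun g => by
    rw [hy, add_sub_cancel_left, zmodToWitt_eq_natCast]⟩

end Witt

section Perfect

variable {p : ℕ} [Fact p.Prime] {n : ℕ} {K : Type*} [Field K] [CharP K p]

/-- For perfect `K`, the `pᵏ`-torsion of `W_n(K) / ℘(W_n(K))` is divisible by `pⁿ⁻ᵏ`. -/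
theorem WittModP.exists_eq_nsmul_of_nsmul_eq_zero [PerfectField K] {k : ℕ} (hk : k ≤ n)
    {m : WittModP p n K} (hm : p ^ k • m = 0) : ∃ m', m = p ^ (n - k) • m' := by
  -- This is where perfectness enters: the kernel of truncation is the ideal generated by `p ^ N`.
  have hker {N : ℕ} {x : WittVector p K} (hx : WittVector.truncate N x = 0) :
      ∃ u, x = (p : WittVector p K) ^ N * u := by
    have := PerfectField.toPerfectRing (K := K) p
    rw [← RingHom.mem_ker, WittVector.mem_ker_truncate,
      ← WittVector.mem_span_p_pow_iff_le_coeff_eq_zero, Ideal.mem_span_singleton] at hx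
    exact hx
  obtain ⟨w, rfl⟩ := QuotientAddGroup.mk_surjective m
  obtain ⟨w, rfl⟩ := WittVector.truncate_surjective p n K w
  rw [← QuotientAddGroup.mk_nsmul, QuotientAddGroup.eq_zero_iff] at hm
  obtain ⟨z, hz⟩ := hm
  obtain ⟨z, rfl⟩ := WittVector.truncate_surjective p n K z
  rw [wittP_truncate, ← map_nsmul, ← sub_eq_zero, ← map_sub] at hz
  obtain ⟨u, hu⟩ := hker hz
  have hp : (p : WittVector p K) ^ n = p ^ k * p ^ (n - k) := by
    rw [← pow_add, Nat.add_sub_cancel' hk]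
  have hzk : wittP p k K (WittVector.truncate k z) = 0 := by
    rw [wittP_truncate, ← RingHom.mem_ker, WittVector.mem_ker_truncate]
    -- Since `℘(z)` vanishes modulo `pᵏ`, `z` is an integer `j` modulo `pᵏ`, say `z = j - pᵏ v`. As
    -- `℘(j) = 0`, cancelling `pᵏ` in the domain `W(K)` gives `w = ℘(-v) - pⁿ⁻ᵏ u`.
    have : WittVector.frobenius z - z = (w + p ^ (n - k) * u) * p ^ k := by
      rw [nsmul_eq_mul, hp] at hu
      push_cast at hu
      linear_combination hu
    intro i hi
    rw [this, WittVector.mul_pow_charP_coeff_zero _ hi]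
  obtain ⟨j, hj⟩ := wittP_eq_zero_iff.mp hzk
  rw [zmodToWitt_eq_natCast, ← map_natCast (WittVector.truncate k), ← sub_eq_zero, ← map_sub] at hj
  obtain ⟨v, hv⟩ := hker hj
  have hz : z = j.val - p ^ k * v := by linear_combination -hv
  have hw : w = WittVector.frobenius (-v) - (-v) - p ^ (n - k) * u := by
    have h0 : (p : WittVector p K) ^ k ≠ 0 := pow_ne_zero _ (WittVector.p_nonzero p K)
    apply mul_left_cancel₀ h0
    rw [hz, nsmul_eq_mul, hp] at hu
    simp only [map_sub, map_mul, map_pow, map_natCast, map_neg] at hu ⊢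
    push_cast at hu
    linear_combination -hu
  refine ⟨QuotientAddGroup.mk (WittVector.truncate n (-u)), ?_⟩
  rw [← QuotientAddGroup.mk_nsmul, QuotientAddGroup.eq_iff_sub_mem]
  refine ⟨WittVector.truncate n (-v), ?_⟩
  rw [wittP_truncate, ← map_nsmul, ← map_sub]
  congr 1
  rw [hw, nsmul_eq_mul]
  push_cast
  ring

end Perfect

end Galois

/-! ### Duality for finite abelian groups killed by `pⁿ` -/

section FiniteDuality

variable {p : ℕ} [Fact p.Prime] {n : ℕ} {A : Type*} [AddCommGroup A]

theorem ZMod.exists_eq_nsmul_of_nsmul_eq_zero {k : ℕ} (hk : k ≤ n) {x : ZMod (p ^ n)}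
    (hx : p ^ k • x = 0) : ∃ y : ZMod (p ^ n), x = p ^ (n - k) • y := by
  rw [← ZMod.natCast_zmod_val x, nsmul_eq_mul, ← Nat.cast_mul, ZMod.natCast_eq_zero_iff] at hx
  have h : p ^ k * p ^ (n - k) ∣ p ^ k * x.val := by rwa [← pow_add, Nat.add_sub_cancel' hk]
  obtain ⟨c, hc⟩ := Nat.dvd_of_mul_dvd_mul_left (pow_pos (Fact.out : p.Prime).pos k) h
  refine ⟨c, ?_⟩
  rw [nsmul_eq_mul, ← Nat.cast_mul, ← hc, ZMod.natCast_zmod_val]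

/-- Generators of a finite abelian group of exponent dividing `pⁿ` with a dual family of
characters. -/
theorem exists_dual_generators [Finite A] (hA : ∀ a : A, p ^ n • a = 0) :
    ∃ (ι : Type) (_ : Fintype ι) (_ : DecidableEq ι) (k : ι → ℕ) (e : ι → A)
      (χ : ι → A →+ ZMod (p ^ n)), (∀ i, k i ≤ n) ∧ (∀ i, p ^ k i • e i = 0) ∧
      (∀ i j, χ i (e j) = if i = j then ((p ^ (n - k i) : ℕ) : ZMod (p ^ n)) else 0) ∧
      ∀ a, ∃ c : ι → ℕ, a = ∑ i, c i • e i := by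
  classical
  obtain ⟨ι, _, m, -, ⟨f⟩⟩ := AddCommGroup.equiv_directSum_zmod_of_finite' A
  have hm (i : ι) : ∃ k ≤ n, m i = p ^ k := by
    rw [← Nat.dvd_prime_pow Fact.out, ← ZMod.natCast_eq_zero_iff]
    have h := congrArg f (hA (f.symm (DirectSum.of (fun i => ZMod (m i)) i 1)))
    rw [map_nsmul, f.apply_symm_apply, map_zero, ← map_nsmul, nsmul_one] at h
    exact DirectSum.of_injective i (h.trans (map_zero _).symm)
  choose k hk hm using hm
  obtain rfl : m = fun i => p ^ k i := funext hm
  have hlift (i : ι) : zmultiplesHom (ZMod (p ^ n)) ((p ^ (n - k i) : ℕ) : ZMod (p ^ n))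
      ((p ^ k i : ℕ) : ℤ) = 0 := by
    rw [zmultiplesHom_apply, natCast_zsmul, nsmul_eq_mul, ← Nat.cast_mul, ← pow_add,
      Nat.add_sub_cancel' (hk i), ZMod.natCast_self]
  let χ (i : ι) : A →+ ZMod (p ^ n) := (ZMod.lift (p ^ k i)
    ⟨zmultiplesHom (ZMod (p ^ n)) ((p ^ (n - k i) : ℕ) : ZMod (p ^ n)), hlift i⟩).comp
    ((DFinsupp.evalAddMonoidHom i).comp f.toAddMonoidHom)
  refine ⟨ι, inferInstance, inferInstance, k, fun i => f.symm (DirectSum.of _ i 1), χ, hk, ?_, ?_,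
    ?_⟩
  · intro i
    apply f.injective
    rw [map_nsmul, f.apply_symm_apply, ← map_nsmul, nsmul_one, ZMod.natCast_self]
    simp
  · intro i j
    have h1 : χ i (f.symm (DirectSum.of _ j 1)) = ZMod.lift (p ^ k i)
      ⟨zmultiplesHom (ZMod (p ^ n)) ((p ^ (n - k i) : ℕ) : ZMod (p ^ n)), hlift i⟩
      ((f (f.symm (DirectSum.of (fun i => ZMod (p ^ k i)) j 1))) i) := rfl
    rw [h1, f.apply_symm_apply]
    split_ifs with h
    · subst h
      rw [DirectSum.of_eq_same]
      have := ZMod.lift_coe (p ^ k i)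
        ⟨zmultiplesHom (ZMod (p ^ n)) ((p ^ (n - k i) : ℕ) : ZMod (p ^ n)), hlift i⟩ 1
      rw [Int.cast_one] at this
      rw [this]
      simp
    · rw [DirectSum.of_eq_of_ne _ _ _ h, map_zero]
  · intro a
    refine ⟨fun i => (f a i).val, ?_⟩
    apply f.injective
    rw [map_sum]
    conv_lhs => rw [← DirectSum.sum_univ_of (f a)]
    refine Finset.sum_congr rfl fun i _ => ?_
    rw [map_nsmul, f.apply_symm_apply, ← map_nsmul, nsmul_one, ZMod.natCast_zmod_val]

theorem pow_nsmul_eq_zero_of_module {p n : ℕ} {M : Type*} [AddCommGroup M]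
    [Module (ZMod (p ^ n)) M] (a : M) : p ^ n • a = 0 := by
  rw [← Nat.cast_smul_eq_nsmul (ZMod (p ^ n)), ZMod.natCast_self, zero_smul]

variable [Module (ZMod (p ^ n)) A] {M : Type*} [AddCommGroup M] [Module (ZMod (p ^ n)) M]

/-- `A ⊗ M → Hom(A^∨, M)` is an isomorphism if `A` is finite and the `pᵏ`-torsion of `M` is
divisible by `pⁿ⁻ᵏ`. -/
theorem tensorToHom_bijective [Finite A]
    (hM : ∀ k ≤ n, ∀ m : M, p ^ k • m = 0 → ∃ m', m = p ^ (n - k) • m') :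
    Function.Bijective (tensorToHom (p ^ n) A M) := by
  obtain ⟨ι, _, _, k, e, χ, hk, he, hχ, hspan⟩ :=
    exists_dual_generators (p := p) (n := n) (A := A) pow_nsmul_eq_zero_of_module
  have heval (m : ι → M) (j : ι) :
      tensorToHom (p ^ n) A M (∑ i, e i ⊗ₜ m i) (χ j) = p ^ (n - k j) • m j := by
    rw [map_sum, AddMonoidHom.finsetSum_apply]
    simp only [tensorToHom_tmul, hχ, ite_smul, zero_smul, Finset.sum_ite_eq, Finset.mem_univ,
      if_true, Nat.cast_smul_eq_nsmul]
  constructor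
  · rw [injective_iff_map_eq_zero]
    intro t ht
    have htm : ∃ m : ι → M, t = ∑ i, e i ⊗ₜ[ZMod (p ^ n)] m i := by
      clear ht
      induction t with
      | zero => exact ⟨0, by simp⟩
      | tmul a m =>
        obtain ⟨c, rfl⟩ := hspan a
        refine ⟨fun i => c i • m, ?_⟩
        rw [TensorProduct.sum_tmul]
        refine Finset.sum_congr rfl fun i _ => ?_
        rw [← Nat.cast_smul_eq_nsmul (ZMod (p ^ n)), TensorProduct.smul_tmul,
          Nat.cast_smul_eq_nsmul]
      | add s t hs ht =>
        obtain ⟨m, rfl⟩ := hs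
        obtain ⟨m', rfl⟩ := ht
        exact ⟨m + m', by simp [TensorProduct.tmul_add, Finset.sum_add_distrib]⟩
    obtain ⟨m, rfl⟩ := htm
    refine Finset.sum_eq_zero fun j _ => ?_
    have h := heval m j
    rw [ht, AddMonoidHom.zero_apply] at h
    -- The hypothesis is used with exponent `n - k j`: it makes `m j` a multiple of `p ^ k j`, a
    -- factor that moves across the tensor and kills `e j`.
    obtain ⟨m', hm'⟩ := hM _ (Nat.sub_le n (k j)) (m j) h.symm
    rw [Nat.sub_sub_self (hk j)] at hm'
    rw [hm', ← Nat.cast_smul_eq_nsmul (ZMod (p ^ n)), TensorProduct.tmul_smul,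
      TensorProduct.smul_tmul', Nat.cast_smul_eq_nsmul, he, TensorProduct.zero_tmul]
  · intro θ
    -- The character `χ j` is killed by `p ^ k j`, hence so is `θ (χ j)`. Since the `χ j` generate
    -- the dual, matching `θ` on them suffices.
    have hθ (j : ι) : ∃ m, θ (χ j) = p ^ (n - k j) • m := by
      have h0 : p ^ k j • χ j = 0 := by
        ext a
        obtain ⟨c, rfl⟩ := hspan a
        simp only [map_sum, map_nsmul, AddMonoidHom.nsmul_apply, hχ, AddMonoidHom.zero_apply]
        refine Finset.sum_congr rfl fun i _ => ?_
        split_ifs with h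
        · rw [nsmul_eq_mul (p ^ k j), ← Nat.cast_mul, ← pow_add, Nat.add_sub_cancel' (hk j),
            ZMod.natCast_self]
        · rw [smul_zero]
      refine hM _ (hk j) _ ?_
      rw [← map_nsmul, h0, map_zero]
    choose m hm using hθ
    refine ⟨∑ i, e i ⊗ₜ[ZMod (p ^ n)] m i, ?_⟩
    ext ψ
    have hψ (i : ι) : ∃ d : ZMod (p ^ n), ψ (e i) = p ^ (n - k i) • d :=
      ZMod.exists_eq_nsmul_of_nsmul_eq_zero (hk i) (by rw [← map_nsmul, he, map_zero])
    choose d hd using hψ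
    have hψ : ψ = ∑ i, (d i).val • χ i := by
      ext a
      obtain ⟨c, rfl⟩ := hspan a
      simp only [map_sum, map_nsmul, AddMonoidHom.finsetSum_apply, AddMonoidHom.nsmul_apply, hχ]
      refine Finset.sum_congr rfl fun i _ => ?_
      simp [hd, mul_comm]
    have hT := heval m
    generalize ∑ i, e i ⊗ₜ[ZMod (p ^ n)] m i = T at hT ⊢
    rw [hψ, map_sum, map_sum]
    refine Finset.sum_congr rfl fun i _ => ?_
    rw [map_nsmul, map_nsmul, hT, hm]

/-- For `M = ℤ/pⁿ` the tensor product is `A` itself and `tensorToHom` is evaluation into the bidual;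
its injectivity gives this lemma, its surjectivity the next. -/
theorem eq_of_forall_character_eq [Finite A] {a b : A}
    (h : ∀ χ : A →+ ZMod (p ^ n), χ a = χ b) : a = b := by
  have hinj := (tensorToHom_bijective (p := p) (n := n) (A := A) (M := ZMod (p ^ n))
    fun k hk _ => ZMod.exists_eq_nsmul_of_nsmul_eq_zero hk).1
  have : a ⊗ₜ[ZMod (p ^ n)] (1 : ZMod (p ^ n)) = b ⊗ₜ 1 := by
    refine hinj (AddMonoidHom.ext fun χ => ?_)
    rw [tensorToHom_tmul, tensorToHom_tmul, h]
  simpa using congrArg (TensorProduct.rid (ZMod (p ^ n)) A) this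

theorem exists_eval_eq_of_bidual [Finite A] (θ : (A →+ ZMod (p ^ n)) →+ ZMod (p ^ n)) :
    ∃ a : A, ∀ χ, θ χ = χ a := by
  obtain ⟨t, rfl⟩ := (tensorToHom_bijective (p := p) (n := n) (A := A) (M := ZMod (p ^ n))
    fun k hk _ => ZMod.exists_eq_nsmul_of_nsmul_eq_zero hk).2 θ
  refine ⟨TensorProduct.rid (ZMod (p ^ n)) A t, fun χ => ?_⟩
  obtain ⟨a, rfl⟩ := (TensorProduct.rid (ZMod (p ^ n)) A).symm.surjective t
  rw [LinearEquiv.apply_symm_apply, TensorProduct.rid_symm_apply, tensorToHom_tmul, smul_eq_mul,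
    mul_one]

end FiniteDuality

/-! ### Coboundaries are twists -/

section Coboundary

variable {K : Type*} [CommRing K] {H : Type*} [CommRing H] [Bialgebra K H]

theorem counitLeft_comul (x : H) : counitLeft K H (Coalgebra.comul (R := K) x) = x := by
  have := congrArg (TensorProduct.lid K H) (Coalgebra.rTensor_counit_comul (R := K) x)
  rw [TensorProduct.lid_tmul, one_smul] at this
  exact this

theorem counitRight_comul (x : H) : counitRight K H (Coalgebra.comul (R := K) x) = x := by
  have := congrArg (TensorProduct.rid K H) (Coalgebra.lTensor_counit_comul (R := K) x)
  rw [TensorProduct.rid_tmul, one_smul] at this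
  exact this

/-- Applying `ε ⊗ id` gives `x = ε(x) x`, so the normalization in the gauge group is automatic for a
trivializing unit. -/
theorem counit_eq_one_of_comul_eq {x : Hˣ} {J : H ⊗[K] H} (hJ : counitLeft K H J = 1)
    (h : J * Coalgebra.comul (R := K) (x : H) = (x : H) ⊗ₜ (x : H)) :
    algebraMap K H (Coalgebra.counit (x : H)) = 1 := by
  have := congrArg (counitLeft K H) h
  rw [map_mul, hJ, one_mul, counitLeft_comul] at this
  have h2 : counitLeft K H ((x : H) ⊗ₜ (x : H)) = algebraMap K H (Coalgebra.counit (x : H)) * x := by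
    simp [counitLeft, Algebra.smul_def]
  rw [h2] at this
  exact (x.isUnit.mul_right_cancel (by rw [← this, one_mul])).symm

/-- An element `J` with `J Δ(x) = x ⊗ x` is a twist. -/
theorem mem_twistGroup_of_mul_comul_eq (x : Hˣ) (hx : Coalgebra.counit (R := K) (x : H) = 1)
    (J : (H ⊗[K] H)ˣ)
    (h : (J : H ⊗[K] H) * Coalgebra.comul (R := K) (x : H) = (x : H) ⊗ₜ (x : H)) :
    J ∈ twistGroup K H := by
  have hΔ : IsUnit (Coalgebra.comul (R := K) (x : H)) :=
    x.isUnit.map (Bialgebra.comulAlgHom K H)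
  refine ⟨?_, ?_, ?_⟩
  · have hL := congrArg (comulLeft K H) h
    have hT := congrArg (tensorOne K H) h
    have hR := congrArg (comulRight K H) h
    have hO := congrArg (oneTensor K H) h
    have eL : comulLeft K H ((x : H) ⊗ₜ (x : H)) =
        tensorOne K H (Coalgebra.comul (R := K) (x : H)) * (1 ⊗ₜ (1 ⊗ₜ (x : H))) := by
      have h1 : (1 : H) ⊗ₜ[K] ((1 : H) ⊗ₜ[K] (x : H)) =
        Algebra.TensorProduct.assoc K K K H H H (1 ⊗ₜ (x : H)) := by
          rw [Algebra.TensorProduct.one_def]; rfl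
      have h2 : Coalgebra.comul (R := K) (x : H) ⊗ₜ[K] (x : H) =
        (Coalgebra.comul (R := K) (x : H) ⊗ₜ[K] (1 : H)) * (1 ⊗ₜ (x : H)) := by simp
      rw [h1]
      refine Eq.trans ?_ (map_mul (Algebra.TensorProduct.assoc K K K H H H) _ _)
      exact congrArg (Algebra.TensorProduct.assoc K K K H H H) h2
    have eT : tensorOne K H ((x : H) ⊗ₜ (x : H)) = (x : H) ⊗ₜ ((x : H) ⊗ₜ 1) := rfl
    have eR : comulRight K H ((x : H) ⊗ₜ (x : H)) =
        oneTensor K H (Coalgebra.comul (R := K) (x : H)) * ((x : H) ⊗ₜ 1) := by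
      simp [comulRight, oneTensor]
    have eO : oneTensor K H ((x : H) ⊗ₜ (x : H)) = 1 ⊗ₜ ((x : H) ⊗ₜ (x : H)) := rfl
    rw [map_mul, eL] at hL
    rw [map_mul, eT] at hT
    rw [map_mul, eR] at hR
    rw [map_mul, eO] at hO
    -- Either side of the twist equation, multiplied by the iterated coproduct of `x`, equals `x ⊗ x
    -- ⊗ x`; coassociativity lets this unit be cancelled.
    have cL : comulLeft K H J * tensorOne K H J * comulLeft K H (Coalgebra.comul (R := K) (x : H)) =
        (x : H) ⊗ₜ ((x : H) ⊗ₜ (x : H)) := by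
      apply (hΔ.map (tensorOne K H)).mul_right_cancel
      have : (x : H) ⊗ₜ[K] ((x : H) ⊗ₜ[K] (x : H)) =
        ((x : H) ⊗ₜ[K] ((x : H) ⊗ₜ[K] 1)) * (1 ⊗ₜ (1 ⊗ₜ (x : H))) := by simp
      rw [this, ← hT]
      linear_combination tensorOne K H J * tensorOne K H (Coalgebra.comul (R := K) (x : H)) * hL
    have cR : comulRight K H J * oneTensor K H J *
        comulRight K H (Coalgebra.comul (R := K) (x : H)) = (x : H) ⊗ₜ ((x : H) ⊗ₜ (x : H)) := by
      apply (hΔ.map (oneTensor K H)).mul_right_cancel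
      have : (x : H) ⊗ₜ[K] ((x : H) ⊗ₜ[K] (x : H)) =
        (1 ⊗ₜ ((x : H) ⊗ₜ[K] (x : H))) * ((x : H) ⊗ₜ 1) := by simp
      rw [this, ← hO]
      linear_combination oneTensor K H J * oneTensor K H (Coalgebra.comul (R := K) (x : H)) * hR
    rw [← comulLeft_comul] at cR
    exact (hΔ.map (comulLeft K H)).mul_right_cancel (cL.trans cR.symm)
  · have := congrArg (counitLeft K H) h
    rw [map_mul, counitLeft_comul] at this
    refine x.isUnit.mul_right_cancel (this.trans ?_)
    simp [counitLeft, hx]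
  · have := congrArg (counitRight K H) h
    rw [map_mul, counitRight_comul] at this
    refine x.isUnit.mul_right_cancel (this.trans ?_)
    simp [counitRight, hx]

end Coboundary

/-! ### Base change and Galois descent for group algebras -/

section Descent

open AddMonoidAlgebra

variable {K L A : Type*} [Field K] [Field L] [AddCommGroup A]

theorem AddMonoidAlgebra.exists_eq_single_of_comul_eq {x : (AddMonoidAlgebra K A)ˣ}
    (h : Coalgebra.comul (R := K) (x : AddMonoidAlgebra K A) =
      (x : AddMonoidAlgebra K A) ⊗ₜ[K] (x : AddMonoidAlgebra K A)) :
    ∃ a, (x : AddMonoidAlgebra K A) = single a 1 := by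
  have h1 := counit_eq_one_of_comul_eq (x := x) (J := 1) (map_one _) (by rw [one_mul, h])
  rw [← map_one (algebraMap K _)] at h1
  obtain ⟨a, ha⟩ := isGroupLikeElem_iff_mem_range_single_one.mp
    (IsGroupLikeElem.mk ((algebraMap K (AddMonoidAlgebra K A)).injective h1) h)
  exact ⟨a, ha.symm⟩

theorem tensor_eq_sum [Fintype A] (T : AddMonoidAlgebra K A ⊗[K] AddMonoidAlgebra K A) :
    T = ∑ a, ∑ b, dualTmul (coeffFunctional K a) (coeffFunctional K b) T •
      (single a 1 ⊗ₜ single b 1) := by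
  classical
  induction T using tensor_induction with
  | zero => simp
  | add S T hS hT =>
    simp only [map_add, add_smul, Finset.sum_add_distrib, ← hS, ← hT]
  | smul_single c a b =>
    simp [Finsupp.single_apply]

theorem tensor_ext [Finite A] {S T : AddMonoidAlgebra K A ⊗[K] AddMonoidAlgebra K A}
    (h : ∀ a b, dualTmul (coeffFunctional K a) (coeffFunctional K b) S =
      dualTmul (coeffFunctional K a) (coeffFunctional K b) T) : S = T := by
  cases nonempty_fintype A
  rw [tensor_eq_sum S, tensor_eq_sum T]
  simp only [h]

theorem tensor₃_ext [Finite A]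
    {S T : AddMonoidAlgebra K A ⊗[K] (AddMonoidAlgebra K A ⊗[K] AddMonoidAlgebra K A)}
    (h : ∀ a b c, dualTmul₃ (coeffFunctional K a) (coeffFunctional K b) (coeffFunctional K c) S =
      dualTmul₃ (coeffFunctional K a) (coeffFunctional K b) (coeffFunctional K c) T) : S = T := by
  classical
  cases nonempty_fintype A
  obtain ⟨r, rfl⟩ := exists_eq_sum_single_tmul S
  obtain ⟨s, rfl⟩ := exists_eq_sum_single_tmul T
  refine Finset.sum_congr rfl fun a _ => ?_
  congr 1
  refine tensor_ext fun b c => ?_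
  simpa [dualTmul₃_tmul, Finsupp.single_apply] using h a b c

/-- The ring homomorphism `K[A] ⊗ K[A] → L[A] ⊗ L[A]` induced by `K → L`. -/
def tensorMap (f : K →+* L) : AddMonoidAlgebra K A ⊗[K] AddMonoidAlgebra K A →+*
    AddMonoidAlgebra L A ⊗[L] AddMonoidAlgebra L A :=
  letI := f.toAlgebra
  (tensorBaseChange A K L).toRingHom

theorem tensorBaseChange_tmul [Algebra K L] (x y : AddMonoidAlgebra K A) :
    tensorBaseChange A K L (x ⊗ₜ y) =
      mapRingHom A (algebraMap K L) x ⊗ₜ mapRingHom A (algebraMap K L) y := by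
  simp [tensorBaseChange]
  rfl

theorem tensorMap_tmul (f : K →+* L) (x y : AddMonoidAlgebra K A) :
    tensorMap f (x ⊗ₜ y) = mapRingHom A f x ⊗ₜ mapRingHom A f y :=
  letI := f.toAlgebra
  tensorBaseChange_tmul x y

theorem tensorMap_algebraMap [Algebra K L] (T : AddMonoidAlgebra K A ⊗[K] AddMonoidAlgebra K A) :
    tensorMap (algebraMap K L) T = tensorBaseChange A K L T := by
  induction T with
  | zero => simp
  | tmul x y => rw [tensorMap_tmul, tensorBaseChange_tmul]
  | add S T hS hT => simp only [map_add, hS, hT]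

theorem tensorMap_comul (f : K →+* L) (x : AddMonoidAlgebra K A) :
    tensorMap f (Coalgebra.comul (R := K) x) = Coalgebra.comul (R := L) (mapRingHom A f x) := by
  induction x using AddMonoidAlgebra.induction_linear with
  | zero => simp
  | add x y hx hy => simp only [map_add, hx, hy]
  | single a c =>
    rw [AddMonoidAlgebra.comul_single, AddMonoidAlgebra.mapRingHom_single,
      AddMonoidAlgebra.comul_single]
    simp [tensorMap_tmul]

theorem dualTmul_tensorMap (f : K →+* L) (a b : A)
    (T : AddMonoidAlgebra K A ⊗[K] AddMonoidAlgebra K A) :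
    dualTmul (coeffFunctional L a) (coeffFunctional L b) (tensorMap f T) =
      f (dualTmul (coeffFunctional K a) (coeffFunctional K b) T) := by
  induction T with
  | zero => simp
  | tmul x y => simp [tensorMap_tmul]
  | add S T hS hT => simp only [map_add, hS, hT]

theorem tensorBaseChange_injective [Finite A] [Algebra K L] :
    Function.Injective (tensorBaseChange A K L) := by
  intro S T h
  refine tensor_ext fun a b => (algebraMap K L).injective ?_
  rw [← dualTmul_tensorMap, ← dualTmul_tensorMap, tensorMap_algebraMap, tensorMap_algebraMap, h]

theorem counit_mapRingHom (f : K →+* L) (x : AddMonoidAlgebra K A) :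
    Coalgebra.counit (R := L) (mapRingHom A f x) = f (Coalgebra.counit (R := K) x) := by
  induction x using AddMonoidAlgebra.induction_linear with
  | zero => simp
  | add x y hx hy => simp only [map_add, hx, hy]
  | single a c => simp

/-- The base change map `K[A] ⊗ K[A] ⊗ K[A] → L[A] ⊗ L[A] ⊗ L[A]`. -/
def tensorBaseChange₃ (A K L : Type*) [AddCommGroup A] [Field K] [Field L] [Algebra K L] :
    AddMonoidAlgebra K A ⊗[K] (AddMonoidAlgebra K A ⊗[K] AddMonoidAlgebra K A) →ₐ[K]
      AddMonoidAlgebra L A ⊗[L] (AddMonoidAlgebra L A ⊗[L] AddMonoidAlgebra L A) :=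
  Algebra.TensorProduct.lift
    (((Algebra.TensorProduct.includeLeft : AddMonoidAlgebra L A →ₐ[L] _).restrictScalars K).comp
      (AddMonoidAlgebra.mapAlgHom A (Algebra.ofId K L)))
    (((Algebra.TensorProduct.includeRight :
      AddMonoidAlgebra L A ⊗[L] AddMonoidAlgebra L A →ₐ[L] _).restrictScalars K).comp
      (tensorBaseChange A K L))
    fun _ _ => mul_comm (G := AddMonoidAlgebra L A ⊗[L] (AddMonoidAlgebra L A ⊗[L]
      AddMonoidAlgebra L A)) _ _

theorem comulLeft_single_tmul_single (a b : A) :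
    comulLeft K (AddMonoidAlgebra K A) (single a 1 ⊗ₜ single b 1) =
      single a 1 ⊗ₜ (single a 1 ⊗ₜ single b 1) := by
  simp [comulLeft]

theorem comulRight_single_tmul_single (a b : A) :
    comulRight K (AddMonoidAlgebra K A) (single a 1 ⊗ₜ single b 1) =
      single a 1 ⊗ₜ (single b 1 ⊗ₜ single b 1) := by
  simp [comulRight]

theorem counitLeft_smul_single (c : K) (a b : A) :
    counitLeft K (AddMonoidAlgebra K A) (c • (single a 1 ⊗ₜ single b 1)) = single b c := by
  rw [map_smul]
  simp [counitLeft]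

theorem counitRight_smul_single (c : K) (a b : A) :
    counitRight K (AddMonoidAlgebra K A) (c • (single a 1 ⊗ₜ single b 1)) = single a c := by
  rw [map_smul]
  simp [counitRight]

section

variable [Algebra K L]

theorem tensorBaseChange₃_tmul (x : AddMonoidAlgebra K A)
    (T : AddMonoidAlgebra K A ⊗[K] AddMonoidAlgebra K A) :
    tensorBaseChange₃ A K L (x ⊗ₜ T) =
      mapRingHom A (algebraMap K L) x ⊗ₜ tensorBaseChange A K L T := by
  refine (Algebra.TensorProduct.lift_tmul _ _ _ _ _).trans ?_
  change (mapRingHom A (algebraMap K L) x ⊗ₜ 1) * (1 ⊗ₜ tensorBaseChange A K L T) = _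
  rw [Algebra.TensorProduct.tmul_mul_tmul, mul_one, one_mul]

theorem tensorBaseChange₃_injective [Finite A] :
    Function.Injective (tensorBaseChange₃ A K L) := by
  have key (T) (a b c : A) : dualTmul₃ (coeffFunctional L a) (coeffFunctional L b)
      (coeffFunctional L c) (tensorBaseChange₃ A K L T) = algebraMap K L
        (dualTmul₃ (coeffFunctional K a) (coeffFunctional K b) (coeffFunctional K c) T) := by
    induction T with
    | zero => simp
    | tmul x T =>
      rw [tensorBaseChange₃_tmul, dualTmul₃_tmul, dualTmul₃_tmul, ← tensorMap_algebraMap,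
        dualTmul_tensorMap, map_mul]
      simp
    | add S T hS hT => simp only [map_add, hS, hT]
  intro S T h
  refine tensor₃_ext fun a b c => (algebraMap K L).injective ?_
  rw [← key, ← key, h]

theorem tensorBaseChange₃_tensorOne (T : AddMonoidAlgebra K A ⊗[K] AddMonoidAlgebra K A) :
    tensorBaseChange₃ A K L (tensorOne K _ T) = tensorOne L _ (tensorBaseChange A K L T) := by
  induction T with
  | zero => simp
  | tmul x y =>
    have h : tensorOne K _ (x ⊗ₜ[K] y) = x ⊗ₜ (y ⊗ₜ 1) := rfl
    rw [h, tensorBaseChange₃_tmul, tensorBaseChange_tmul, tensorBaseChange_tmul, map_one]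
    rfl
  | add S T hS hT => simp only [map_add, hS, hT]

theorem tensorBaseChange₃_oneTensor (T : AddMonoidAlgebra K A ⊗[K] AddMonoidAlgebra K A) :
    tensorBaseChange₃ A K L (oneTensor K _ T) = oneTensor L _ (tensorBaseChange A K L T) := by
  have h : oneTensor K _ T = (1 : AddMonoidAlgebra K A) ⊗ₜ T := rfl
  rw [h, tensorBaseChange₃_tmul, map_one]
  rfl

theorem tensorBaseChange₃_comulLeft (T : AddMonoidAlgebra K A ⊗[K] AddMonoidAlgebra K A) :
    tensorBaseChange₃ A K L (comulLeft K _ T) = comulLeft L _ (tensorBaseChange A K L T) := by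
  induction T using tensor_induction with
  | zero => simp
  | add S T hS hT => simp only [map_add, hS, hT]
  | smul_single c a b =>
    rw [tensorBaseChange_smul_single, map_smul, map_smul, map_smul, comulLeft_single_tmul_single,
      comulLeft_single_tmul_single, tensorBaseChange₃_tmul,
      tensorBaseChange_tmul, algebraMap_smul]
    simp

theorem tensorBaseChange₃_comulRight (T : AddMonoidAlgebra K A ⊗[K] AddMonoidAlgebra K A) :
    tensorBaseChange₃ A K L (comulRight K _ T) = comulRight L _ (tensorBaseChange A K L T) := by
  induction T using tensor_induction with
  | zero => simp
  | add S T hS hT => simp only [map_add, hS, hT]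
  | smul_single c a b =>
    rw [tensorBaseChange_smul_single, map_smul, map_smul, map_smul, comulRight_single_tmul_single,
      comulRight_single_tmul_single, tensorBaseChange₃_tmul,
      tensorBaseChange_tmul, algebraMap_smul]
    simp

theorem mapRingHom_counitLeft (T : AddMonoidAlgebra K A ⊗[K] AddMonoidAlgebra K A) :
    mapRingHom A (algebraMap K L) (counitLeft K _ T) =
      counitLeft L _ (tensorBaseChange A K L T) := by
  induction T using tensor_induction with
  | zero => simp
  | add S T hS hT => simp only [map_add, hS, hT]
  | smul_single c a b =>
    rw [tensorBaseChange_smul_single, counitLeft_smul_single, counitLeft_smul_single,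
      mapRingHom_single]

theorem mapRingHom_counitRight (T : AddMonoidAlgebra K A ⊗[K] AddMonoidAlgebra K A) :
    mapRingHom A (algebraMap K L) (counitRight K _ T) =
      counitRight L _ (tensorBaseChange A K L T) := by
  induction T using tensor_induction with
  | zero => simp
  | add S T hS hT => simp only [map_add, hS, hT]
  | smul_single c a b =>
    rw [tensorBaseChange_smul_single, counitRight_smul_single, counitRight_smul_single,
      mapRingHom_single]

theorem mapRingHom_algebraMap_injective :
    Function.Injective (mapRingHom A (algebraMap K L)) := by
  intro x y h
  ext a
  apply (algebraMap K L).injective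
  rw [← coeff_mapRingHom, ← coeff_mapRingHom, h]

/-- A unit of `K[A] ⊗ K[A]` that becomes a twist over an extension field is a twist. -/
theorem mem_twistGroup_of_tensorBaseChange [Finite A]
    {J : (AddMonoidAlgebra K A ⊗[K] AddMonoidAlgebra K A)ˣ}
    {J' : (AddMonoidAlgebra L A ⊗[L] AddMonoidAlgebra L A)ˣ}
    (hJ : tensorBaseChange A K L J = J') (h : J' ∈ twistGroup L (AddMonoidAlgebra L A)) :
    J ∈ twistGroup K (AddMonoidAlgebra K A) := by
  obtain ⟨h1, h2, h3⟩ := h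
  rw [← hJ] at h1 h2 h3
  refine ⟨tensorBaseChange₃_injective (L := L) ?_, mapRingHom_algebraMap_injective (L := L) ?_,
    mapRingHom_algebraMap_injective (L := L) ?_⟩
  · rw [map_mul, map_mul, tensorBaseChange₃_comulLeft, tensorBaseChange₃_tensorOne,
      tensorBaseChange₃_comulRight, tensorBaseChange₃_oneTensor]
    exact h1
  · rw [mapRingHom_counitLeft, map_one]
    exact h2
  · rw [mapRingHom_counitRight, map_one]
    exact h3

end

section Galois

variable [Algebra K L] [IsGalois K L]

theorem exists_mapRingHom_eq_of_forall_fixed [Finite A] {x : AddMonoidAlgebra L A}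
    (hx : ∀ g : Gal(L/K), mapRingHom A (g : L →+* L) x = x) :
    ∃ x₀, mapRingHom A (algebraMap K L) x₀ = x := by
  cases nonempty_fintype A
  have h (a : A) : ∃ c, algebraMap K L c = x.coeff a :=
    exists_algebraMap_eq_of_forall_fixed fun g => by
      conv_rhs => rw [← hx g, coeff_mapRingHom]
      rfl
  choose c hc using h
  refine ⟨∑ a, single a (c a), ?_⟩
  classical
  ext a
  simp [hc]

theorem exists_tensorBaseChange_eq_of_forall_fixed [Finite A]
    {T : AddMonoidAlgebra L A ⊗[L] AddMonoidAlgebra L A}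
    (hT : ∀ g : Gal(L/K), tensorMap (g : L →+* L) T = T) : ∃ T₀, tensorBaseChange A K L T₀ = T := by
  cases nonempty_fintype A
  have h (a b : A) : ∃ c, algebraMap K L c =
      dualTmul (coeffFunctional L a) (coeffFunctional L b) T :=
    exists_algebraMap_eq_of_forall_fixed fun g => by
      conv_rhs => rw [← hT g, dualTmul_tensorMap]
      rfl
  choose c hc using h
  refine ⟨∑ a, ∑ b, c a b • (single a 1 ⊗ₜ single b 1), ?_⟩
  rw [tensor_eq_sum T]
  simp only [map_sum, tensorBaseChange_smul_single, hc]

end Galois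

end Descent

/-! ### Twists and continuous homomorphisms `G → A` -/

section Trivialization

open AddMonoidAlgebra

variable {K A : Type*} [Field K] [AddCommGroup A]

local notation "Kˢ" => SeparableClosure K

theorem mapRingHom_mapRingHom_algebraMap {L : Type*} [Field L] [Algebra K L] (g : Gal(L/K))
    (x : AddMonoidAlgebra K A) :
    mapRingHom A (g : L →+* L) (mapRingHom A (algebraMap K L) x) =
      mapRingHom A (algebraMap K L) x := by
  ext a
  simp

theorem tensorMap_tensorBaseChange {L : Type*} [Field L] [Algebra K L] (g : Gal(L/K))
    (T : AddMonoidAlgebra K A ⊗[K] AddMonoidAlgebra K A) :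
    tensorMap (g : L →+* L) (tensorBaseChange A K L T) = tensorBaseChange A K L T := by
  induction T with
  | zero => simp
  | tmul x y =>
    rw [tensorBaseChange_tmul, tensorMap_tmul, mapRingHom_mapRingHom_algebraMap,
      mapRingHom_mapRingHom_algebraMap]
  | add S T hS hT => simp only [map_add, hS, hT]

theorem isUnit_single_one (a : A) : IsUnit (single a (1 : K)) :=
  IsUnit.of_mul_eq_one (single (-a) 1) (by rw [single_mul_single, add_neg_cancel, one_mul, one_def])

theorem isUnit_tmul_self (x : (AddMonoidAlgebra K A)ˣ) :
    IsUnit ((x : AddMonoidAlgebra K A) ⊗ₜ[K] (x : AddMonoidAlgebra K A)) := by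
  refine IsUnit.of_mul_eq_one
    (((x⁻¹ : (AddMonoidAlgebra K A)ˣ) : AddMonoidAlgebra K A) ⊗ₜ[K]
      ((x⁻¹ : (AddMonoidAlgebra K A)ˣ) : AddMonoidAlgebra K A)) ?_
  rw [Algebra.TensorProduct.tmul_mul_tmul, Units.mul_inv, Algebra.TensorProduct.one_def]

theorem isUnit_comul (x : (AddMonoidAlgebra K A)ˣ) :
    IsUnit (Coalgebra.comul (R := K) (x : AddMonoidAlgebra K A)) :=
  x.isUnit.map (Bialgebra.comulAlgHom K (AddMonoidAlgebra K A))

/-- If `T = (x ⊗ x) Δ(x)⁻¹` and `f` multiplies `x` by an element of `A`, then `f` fixes `T`. -/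
theorem tensorMap_eq_self_of_mul_comul_eq {f : K →+* K} {x : (AddMonoidAlgebra K A)ˣ} {a : A}
    (hf : mapRingHom A f (x : AddMonoidAlgebra K A) = single a 1 * (x : AddMonoidAlgebra K A))
    {T : AddMonoidAlgebra K A ⊗[K] AddMonoidAlgebra K A}
    (hT : T * Coalgebra.comul (R := K) (x : AddMonoidAlgebra K A) =
      (x : AddMonoidAlgebra K A) ⊗ₜ (x : AddMonoidAlgebra K A)) :
    tensorMap f T = T := by
  have h := congrArg (tensorMap f) hT
  obtain ⟨s, hs⟩ := isUnit_single_one (K := K) a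
  have hs2 : Coalgebra.comul (R := K) (s : AddMonoidAlgebra K A) =
      (s : AddMonoidAlgebra K A) ⊗ₜ[K] (s : AddMonoidAlgebra K A) := by
    rw [hs]
    simp
  rw [map_mul, tensorMap_comul, tensorMap_tmul, hf, ← hs, Bialgebra.comul_mul, hs2,
    ← Algebra.TensorProduct.tmul_mul_tmul, mul_left_comm] at h
  exact (isUnit_comul x).mul_right_cancel (((isUnit_tmul_self s).mul_left_cancel h).trans hT.symm)

/-- Two trivializations of the same unit of `K[A] ⊗ K[A]` differ by an element of `A`. -/
theorem exists_eq_single_mul_of_mul_comul_eq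
    {T : AddMonoidAlgebra K A ⊗[K] AddMonoidAlgebra K A}
    {x y : (AddMonoidAlgebra K A)ˣ}
    (hx : T * Coalgebra.comul (R := K) (x : AddMonoidAlgebra K A) =
      (x : AddMonoidAlgebra K A) ⊗ₜ (x : AddMonoidAlgebra K A))
    (hy : T * Coalgebra.comul (R := K) (y : AddMonoidAlgebra K A) =
      (y : AddMonoidAlgebra K A) ⊗ₜ (y : AddMonoidAlgebra K A)) :
    ∃ a, (y : AddMonoidAlgebra K A) = single a 1 * (x : AddMonoidAlgebra K A) := by
  have hyx : (y : AddMonoidAlgebra K A) = x * (y * x⁻¹ : (AddMonoidAlgebra K A)ˣ) := by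
    rw [← Units.val_mul, mul_comm y, mul_inv_cancel_left]
  obtain ⟨a, ha⟩ := exists_eq_single_of_comul_eq (x := y * x⁻¹) (by
    apply (isUnit_tmul_self x).mul_left_cancel
    rw [Algebra.TensorProduct.tmul_mul_tmul, ← hyx, ← hy, ← hx, mul_assoc,
      ← Bialgebra.comul_mul, ← hyx])
  exact ⟨a, by rw [← ha, mul_comm, ← hyx]⟩

theorem single_one_mul_injective {x : (AddMonoidAlgebra K A)ˣ} {a b : A}
    (h : single a 1 * (x : AddMonoidAlgebra K A) = single b 1 * (x : AddMonoidAlgebra K A)) :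
    a = b :=
  single_left_injective one_ne_zero (x.isUnit.mul_right_cancel h)

theorem Trivializes.map_eq {J : twistGroup K (AddMonoidAlgebra K A)}
    {x : (AddMonoidAlgebra Kˢ A)ˣ} {ρ : Gal(Kˢ/K) → A} (h : Trivializes J x ρ) (g : Gal(Kˢ/K)) :
    mapRingHom A (g : Kˢ →+* Kˢ) (x : AddMonoidAlgebra Kˢ A) =
      single (ρ g) 1 * (x : AddMonoidAlgebra Kˢ A) :=
  h.2 g

theorem Trivializes.mul {J J' : twistGroup K (AddMonoidAlgebra K A)}
    {x x' : (AddMonoidAlgebra Kˢ A)ˣ} {ρ ρ' : Gal(Kˢ/K) → A} (h : Trivializes J x ρ)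
    (h' : Trivializes J' x' ρ') : Trivializes (J * J') (x * x') (ρ + ρ') := by
  refine ⟨?_, fun g => ?_⟩
  · rw [Subgroup.coe_mul, Units.val_mul, Units.val_mul, map_mul, Bialgebra.comul_mul,
      mul_mul_mul_comm, h.1, h'.1, Algebra.TensorProduct.tmul_mul_tmul]
  · rw [Units.val_mul, map_mul, h.2, h'.2, mul_mul_mul_comm, single_mul_single, mul_one,
      Pi.add_apply]

/-- Another trivialization is `a x` with `a ∈ A`. Galois acts trivially on group elements and `A` is
commutative, so the factor `a` cancels. -/
theorem Trivializes.unique {J : twistGroup K (AddMonoidAlgebra K A)}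
    {x x' : (AddMonoidAlgebra Kˢ A)ˣ} {ρ ρ' : Gal(Kˢ/K) → A} (h : Trivializes J x ρ)
    (h' : Trivializes J x' ρ') : ρ = ρ' := by
  obtain ⟨a, ha⟩ := exists_eq_single_mul_of_mul_comul_eq h.1 h'.1
  funext g
  have := h'.map_eq g
  rw [ha, map_mul, h.map_eq, mapRingHom_single, map_one, ← mul_assoc, ← mul_assoc,
    mul_comm (single a _)] at this
  refine single_one_mul_injective (x := (isUnit_single_one a).unit * x) ?_
  rw [Units.val_mul, IsUnit.unit_spec, ← mul_assoc, ← mul_assoc, this]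

theorem Trivializes.isFiniteGaloisHom [Finite A] {J : twistGroup K (AddMonoidAlgebra K A)}
    {x : (AddMonoidAlgebra Kˢ A)ˣ} {ρ : Gal(Kˢ/K) → A} (h : Trivializes J x ρ) :
    IsFiniteGaloisHom ρ := by
  refine ⟨fun g k => single_one_mul_injective (x := x) ?_,
    Set.range fun a => (x : AddMonoidAlgebra Kˢ A).coeff a, Set.finite_range _,
    fun g hg => single_one_mul_injective (x := x) ?_⟩
  · have : mapRingHom A ((g * k : Gal(Kˢ/K)) : Kˢ →+* Kˢ) (x : AddMonoidAlgebra Kˢ A) =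
        mapRingHom A (g : Kˢ →+* Kˢ) (mapRingHom A (k : Kˢ →+* Kˢ) x) := by
      ext a; simp
    rw [← h.map_eq, this, h.map_eq, map_mul, h.map_eq, mapRingHom_single, map_one, ← mul_assoc,
      single_mul_single, mul_one, add_comm]
  · rw [← h.map_eq, ← one_def, one_mul]
    refine AddMonoidAlgebra.ext (Finsupp.ext fun a => ?_)
    rw [coeff_mapRingHom]
    exact hg _ ⟨a, rfl⟩

theorem trivializes_of_gaugeTrivial {J : twistGroup K (AddMonoidAlgebra K A)}
    (hJ : J ∈ gaugeTrivial K (AddMonoidAlgebra K A)) : ∃ x, Trivializes J x 0 := by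
  obtain ⟨x, -, hx⟩ := hJ
  refine ⟨Units.map (mapRingHom A (algebraMap K Kˢ) : _ →* _) x, ?_, fun g => ?_⟩
  · have := congrArg (tensorBaseChange A K Kˢ) hx
    rw [map_mul, ← tensorMap_algebraMap (Coalgebra.comul _), tensorMap_comul,
      tensorBaseChange_tmul] at this
    exact this
  · rw [Pi.zero_apply, ← one_def, one_mul]
    exact mapRingHom_mapRingHom_algebraMap g _

variable {p : ℕ} [Fact p.Prime] {n : ℕ} [CharP K p] [Finite A]

/-- Because `J` is defined over `K`, each conjugate `g(x)` trivializes it again and so differs from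
`x` by an element of `A`. -/
theorem exists_trivializes (hA : ∀ a : A, p ^ n • a = 0) (J : twistGroup K (AddMonoidAlgebra K A)) :
    ∃ x ρ, Trivializes J x ρ := by
  cases nonempty_fintype A
  obtain ⟨x, hx⟩ := exists_trivialization hA Kˢ J
  have h (g : Gal(Kˢ/K)) : ∃ a, mapRingHom A (g : Kˢ →+* Kˢ) (x : AddMonoidAlgebra Kˢ A) =
      single a 1 * (x : AddMonoidAlgebra Kˢ A) := by
    refine exists_eq_single_mul_of_mul_comul_eq hx
      (y := Units.map (mapRingHom A (g : Kˢ →+* Kˢ) : _ →* _) x) ?_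
    have := congrArg (tensorMap (g : Kˢ →+* Kˢ)) hx
    rw [map_mul, tensorMap_tensorBaseChange, tensorMap_comul, tensorMap_tmul] at this
    exact this
  choose ρ hρ using h
  exact ⟨x, ρ, hx, hρ⟩

/-- An invariant `x` descends to `K[A]`; the descended element is a unit because its counit is
nonzero after base change. -/
theorem Trivializes.mem_gaugeTrivial (hA : ∀ a : A, p ^ n • a = 0)
    {J : twistGroup K (AddMonoidAlgebra K A)}
    {x : (AddMonoidAlgebra Kˢ A)ˣ} (h : Trivializes J x 0) :
    J ∈ gaugeTrivial K (AddMonoidAlgebra K A) := by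
  obtain ⟨y, hy⟩ := exists_mapRingHom_eq_of_forall_fixed (K := K)
    (x := (x : AddMonoidAlgebra Kˢ A)) fun g => by
      rw [h.map_eq, Pi.zero_apply, ← one_def, one_mul]
  have hJ : ((J : (AddMonoidAlgebra K A ⊗[K] AddMonoidAlgebra K A)ˣ) :
      AddMonoidAlgebra K A ⊗[K] AddMonoidAlgebra K A) * Coalgebra.comul (R := K) y = y ⊗ₜ y := by
    apply tensorBaseChange_injective (L := Kˢ)
    rw [map_mul, ← tensorMap_algebraMap (Coalgebra.comul _), tensorMap_comul,
      tensorBaseChange_tmul, hy]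
    exact h.1
  have hyu : IsUnit y := by
    refine isUnit_of_counit_ne_zero hA fun h0 => ?_
    have hx : IsUnit (Coalgebra.counit (R := Kˢ) (x : AddMonoidAlgebra Kˢ A)) :=
      x.isUnit.map (Bialgebra.counitAlgHom Kˢ (AddMonoidAlgebra Kˢ A))
    rw [← hy, counit_mapRingHom, h0, map_zero] at hx
    exact not_isUnit_zero hx
  obtain ⟨y, rfl⟩ := hyu
  refine ⟨y, ?_, hJ⟩
  apply (algebraMap K (AddMonoidAlgebra K A)).injective
  rw [map_one]
  exact counit_eq_one_of_comul_eq J.2.2.1 hJ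

/-- Every continuous homomorphism from the Galois group to `A` arises from a twist. -/
theorem IsFiniteGaloisHom.exists_trivializes (hA : ∀ a : A, p ^ n • a = 0)
    {ρ : Gal(Kˢ/K) → A} (hρ : IsFiniteGaloisHom ρ) :
    ∃ (J : twistGroup K (AddMonoidAlgebra K A)) (x : (AddMonoidAlgebra Kˢ A)ˣ),
      Trivializes J x ρ := by
  obtain ⟨Q, _, act, t, c, ht, hc, hsum⟩ := hρ.exists_orbit
  -- The sign makes `g(y) = ρ(g) y`, since `-c q = ρ(g) - c(g q)`. The trace condition gives `ε(y) =
  -- 1`, so `y` is invertible.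
  set y : AddMonoidAlgebra Kˢ A := ∑ q, single (-c q) (t q) with hy
  have hcy : Coalgebra.counit (R := Kˢ) y = 1 := by
    rw [hy, map_sum, ← hsum]
    simp
  have hgy (g : Gal(Kˢ/K)) : mapRingHom A (g : Kˢ →+* Kˢ) y = single (ρ g) 1 * y := by
    rw [hy, map_sum, Finset.mul_sum, ← Equiv.sum_comp (act g) fun q => single (ρ g) 1 * _]
    refine Finset.sum_congr rfl fun q _ => ?_
    rw [mapRingHom_single, single_mul_single, one_mul, hc, ← ht]
    congr 1
    abel
  obtain ⟨x, hx⟩ : IsUnit y := isUnit_of_counit_ne_zero hA (by rw [hcy]; exact one_ne_zero)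
  rw [← hx] at hcy hgy
  obtain ⟨X, hX⟩ := isUnit_tmul_self x
  obtain ⟨D, hD⟩ := isUnit_comul x
  have hXD : ((X * D⁻¹ : (AddMonoidAlgebra Kˢ A ⊗[Kˢ] AddMonoidAlgebra Kˢ A)ˣ) :
      AddMonoidAlgebra Kˢ A ⊗[Kˢ] AddMonoidAlgebra Kˢ A) *
        Coalgebra.comul (R := Kˢ) (x : AddMonoidAlgebra Kˢ A) =
      (x : AddMonoidAlgebra Kˢ A) ⊗ₜ (x : AddMonoidAlgebra Kˢ A) := by
    rw [← hD, ← hX, ← Units.val_mul, inv_mul_cancel_right]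
  generalize X * D⁻¹ = U at hXD
  have hU (g : Gal(Kˢ/K)) := tensorMap_eq_self_of_mul_comul_eq (hgy g) hXD
  -- The inverse is descended as well, so that the descended element is a unit over `K`.
  have hU' (g : Gal(Kˢ/K)) : tensorMap (g : Kˢ →+* Kˢ) U.inv = U.inv := by
    apply U.isUnit.mul_left_cancel
    rw [U.val_inv]
    conv_lhs => rw [← hU g, ← map_mul, U.val_inv, map_one]
  obtain ⟨J, hJ⟩ := exists_tensorBaseChange_eq_of_forall_fixed hU
  obtain ⟨J', hJ'⟩ := exists_tensorBaseChange_eq_of_forall_fixed hU'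
  have hJJ' : J * J' = 1 := by
    apply tensorBaseChange_injective (L := Kˢ)
    rw [map_mul, hJ, hJ', U.val_inv, map_one]
  refine ⟨⟨_, mem_twistGroup_of_tensorBaseChange (L := Kˢ)
    (J := ⟨J, J', hJJ', by rw [mul_comm, hJJ']⟩) hJ
    (mem_twistGroup_of_mul_comul_eq x hcy _ hXD)⟩, x, ?_, hgy⟩
  rw [← hXD, ← hJ]

end Trivialization

/-! ### Assembling the isomorphism -/

section Classification

variable (p : ℕ) [Fact p.Prime] (n : ℕ) (K : Type*) [Field K] [CharP K p]
  (A : Type*) [AddCommGroup A] [Finite A] [Module (ZMod (p ^ n)) A]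

theorem IsFiniteGaloisHom.comp {p n : ℕ} {K L A : Type*} [Field K] [Field L] [Algebra K L]
    [AddCommGroup A] {ρ : Gal(L/K) → A} (hρ : IsFiniteGaloisHom ρ) (χ : A →+ ZMod (p ^ n)) :
    IsFiniteGaloisHom fun g => χ (ρ g) := by
  obtain ⟨hadd, s, hs, hfix⟩ := hρ
  exact ⟨fun g h => by simp only [hadd, map_add], s, hs,
    fun g hg => by simp only [hfix g hg, map_zero]⟩

/-- The homomorphism that sends a twist to the Artin-Schreier-Witt classes of its characters. -/
theorem exists_twistGroup_hom :
    ∃ Φ : twistGroup K (AddMonoidAlgebra K A) →*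
        Multiplicative ((A →+ ZMod (p ^ n)) →+ WittModP p n K),
      ∀ J, ∃ (x : (AddMonoidAlgebra (SeparableClosure K) A)ˣ)
        (ρ : Gal(SeparableClosure K/K) → A), Trivializes J x ρ ∧
          ∀ χ : A →+ ZMod (p ^ n),
            IsArtinSchreierWitt ((Φ J).toAdd χ) fun g => χ (ρ g) := by
  choose x ρ h using exists_trivializes (K := K) (p := p) (n := n) (A := A)
    pow_nsmul_eq_zero_of_module
  choose c hc using fun J (χ : A →+ ZMod (p ^ n)) =>
    (((h J).isFiniteGaloisHom).comp χ).exists_isArtinSchreierWitt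
  have hmul (I J) : ρ (I * J) = ρ I + ρ J := (h (I * J)).unique ((h I).mul (h J))
  let F (J) : (A →+ ZMod (p ^ n)) →+ WittModP p n K := AddMonoidHom.mk' (c J) fun χ ψ =>
    (hc J (χ + ψ)).congr_left ((hc J χ).add (hc J ψ))
  refine ⟨MonoidHom.mk' (fun J => Multiplicative.ofAdd (F J)) fun I J => ?_,
    fun J => ⟨x J, ρ J, h J, hc J⟩⟩
  rw [← ofAdd_add]
  congr 1
  ext χ
  refine (hc (I * J) χ).congr_left ?_
  have := (hc I χ).add (hc J χ)
  simp only [hmul, Pi.add_apply, map_add]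
  exact this

variable {p n K A}

theorem mem_gaugeTrivial_iff_of_trivializes {J : twistGroup K (AddMonoidAlgebra K A)}
    {x : (AddMonoidAlgebra (SeparableClosure K) A)ˣ} {ρ : Gal(SeparableClosure K/K) → A}
    (h : Trivializes J x ρ) {θ : (A →+ ZMod (p ^ n)) →+ WittModP p n K}
    (hθ : ∀ χ, IsArtinSchreierWitt (θ χ) fun g => χ (ρ g)) :
    θ = 0 ↔ J ∈ gaugeTrivial K (AddMonoidAlgebra K A) := by
  constructor
  · rintro rfl
    have hρ : ρ = 0 := by
      funext g
      refine eq_of_forall_character_eq (p := p) (n := n) fun χ => ?_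
      rw [Pi.zero_apply, map_zero]
      exact congrFun (isArtinSchreierWitt_zero_iff_left.mp (hθ χ)) g
    subst hρ
    exact h.mem_gaugeTrivial (p := p) (n := n) pow_nsmul_eq_zero_of_module
  · intro hJ
    obtain ⟨y, hy⟩ := trivializes_of_gaugeTrivial hJ
    obtain rfl := h.unique hy
    ext χ
    have := hθ χ
    simp only [Pi.zero_apply, map_zero] at this
    exact isArtinSchreierWitt_zero_iff_right.mp this

/-- The character attached to `θ χ` is unique, hence additive in `χ`, so at each `g` biduality
yields a point of `A`. The dual of `A` is finite, so finitely many finite sets together control `ρ`.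
-/
theorem exists_isFiniteGaloisHom_of_hom (θ : (A →+ ZMod (p ^ n)) →+ WittModP p n K) :
    ∃ ρ : Gal(SeparableClosure K/K) → A, IsFiniteGaloisHom ρ ∧
      ∀ χ, IsArtinSchreierWitt (θ χ) fun g => χ (ρ g) := by
  choose κ hκ hfin using fun χ => exists_isArtinSchreierWitt_right (θ χ)
  have hadd (χ ψ) : κ (χ + ψ) = κ χ + κ ψ := by
    have h := hκ (χ + ψ)
    rw [map_add] at h
    exact h.congr_right ((hκ χ).add (hκ ψ))
  have hev (g : Gal(SeparableClosure K/K)) : ∃ a, ∀ χ : A →+ ZMod (p ^ n), κ χ g = χ a :=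
    exists_eval_eq_of_bidual (AddMonoidHom.mk' (fun χ => κ χ g) fun χ ψ => by
      rw [hadd, Pi.add_apply])
  choose ρ hρ using hev
  refine ⟨ρ, ⟨fun g k => ?_, ?_⟩, fun χ => ?_⟩
  · refine eq_of_forall_character_eq (p := p) (n := n) fun χ => ?_
    rw [map_add, ← hρ, ← hρ, ← hρ, (hfin χ).1]
  · choose s hs hfix using fun χ => (hfin χ).2
    have : Finite (A →+ ZMod (p ^ n)) := DFunLike.finite _
    refine ⟨⋃ χ, s χ, Set.finite_iUnion hs, fun g hg => ?_⟩
    refine eq_of_forall_character_eq (p := p) (n := n) fun χ => ?_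
    rw [← hρ, map_zero]
    exact hfix χ g fun x hx => hg x (Set.mem_iUnion_of_mem χ hx)
  · simp only [← hρ]
    exact hκ χ

/-- The first isomorphism theorem for an additive target. -/
theorem exists_addEquiv_of_surjective {G B : Type*} [CommGroup G] [AddCommGroup B] {N : Subgroup G}
    {f : G →* Multiplicative B} (hN : N = f.ker) (hf : Function.Surjective f) :
    ∃ e : Additive (G ⧸ N) ≃+ B, ∀ g : G,
      e (Additive.ofMul (QuotientGroup.mk g)) = (f g).toAdd := by
  subst hN
  exact ⟨MulEquiv.toAdditiveLeft (QuotientGroup.quotientKerEquivOfSurjective f hf), fun _ => rfl⟩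

end Classification
end

theorem theorem3p4 (p : ℕ) [Fact p.Prime] (n : ℕ) (K : Type*) [Field K] [CharP K p]
    (A : Type*) [AddCommGroup A] [Finite A] [Module (ZMod (p ^ n)) A] :
    ∃ Φ : Additive (H2inv A K) ≃+ ((A →+ ZMod (p ^ n)) →+ WittModP p n K),
      (∀ J : twistGroup K (AddMonoidAlgebra K A),
        ∃ (x : (AddMonoidAlgebra (SeparableClosure K) A)ˣ) (ρ : Gal(SeparableClosure K/K) → A),
          Trivializes J x ρ ∧
          ∀ χ : A →+ ZMod (p ^ n),
            IsArtinSchreierWitt (Φ (Additive.ofMul (QuotientGroup.mk J)) χ) fun g => χ (ρ g)) ∧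
      (PerfectField K →
        ∃ Ψ : Additive (H2inv A K) ≃+ A ⊗[ZMod (p ^ n)] WittModP p n K,
          ∀ c : Additive (H2inv A K), tensorToHom (p ^ n) A (WittModP p n K) (Ψ c) = Φ c) := by
  obtain ⟨Φ, hΦ⟩ := exists_twistGroup_hom p n K A
  have hker : gaugeTrivial K (AddMonoidAlgebra K A) = Φ.ker := by
    ext J
    obtain ⟨x, ρ, hx, hρ⟩ := hΦ J
    exact (mem_gaugeTrivial_iff_of_trivializes hx hρ).symm
  have hsurj : Function.Surjective Φ := by
    intro θ
    obtain ⟨ρ, hρ, hθ⟩ := exists_isFiniteGaloisHom_of_hom θ.toAdd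
    obtain ⟨J, x, hJ⟩ := hρ.exists_trivializes (p := p) (n := n) pow_nsmul_eq_zero_of_module
    obtain ⟨y, ρ', hy, hρ'⟩ := hΦ J
    -- The homomorphism `ρ` depends only on `J`, so the one built from `θ` is the one defining `Φ
    -- J`; a character has only one class.
    obtain rfl := hJ.unique hy
    exact ⟨J, AddMonoidHom.ext fun χ => (hρ' χ).congr_left (hθ χ)⟩
  obtain ⟨Φ', hΦ'⟩ := exists_addEquiv_of_surjective hker hsurj
  refine ⟨Φ', fun J => ?_, fun _ => ?_⟩
  · rw [hΦ']
    exact hΦ J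
  · let τ := AddEquiv.ofBijective (tensorToHom (p ^ n) A (WittModP p n K))
      (tensorToHom_bijective fun k hk m hm => WittModP.exists_eq_nsmul_of_nsmul_eq_zero hk hm)
    exact ⟨Φ'.trans τ.symm, fun c => τ.apply_symm_apply (Φ' c)⟩
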